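/- Let $C\subseteq\mathbb R^n$ be open and convex, $a>0$, and let $g:C\to\mathbb R$ be $a$-self-concordant, i.e. $g$ is convex and three times continuously differentiable with $$|g'''(x)[h,h,h]|\le 2a^{-1/2}\,(h^Tg''(x)h)^{3/2}\qquad (x\in C,\ h\in\mathbb R^n).$$ For $x\in C$ put $\|v\|_x:=\sqrt{a^{-1}\,v^Tg''(x)v}$ and $W_r(x):=\{z\in\mathbb R^n:\|z-x\|_x<r\}$. Let $x_0\in C$ with $g''(x_0)$ non-singular, and assume that $W_1(x_0)\subseteq C$ or that all sublevel sets $\{x\in C: g(x)\le c\}$, $c\in\mathbb R$, are closed in $\mathbb R^n$. Let $b>0$ and $\theta$ satisfy $$\|g''(x_0)^{-1}g'(x_0)\|_{x_0}\le b<3-2\sqrt2,\qquad 0\le\theta\le\frac{1-2\sqrt b-b}{1+2\sqrt b+b}.$$ Consider the inexact Newton method for $g'(x)=0$ started at $x_0$ with relative residual tolerance $\theta$: for $k=0,1,\dots$, $$x_{k+1}=x_k+S_k,\qquad \|g''(x_0)^{-1}[g'(x_k)+g''(x_k)S_k]\|_{x_0}\le\theta\,\|g''(x_0)^{-1}g'(x_k)\|_{x_0}.$$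 The method is well defined: for any choice of the steps, every iterate lies in $C$, the Hessian there is non-singular, and a further admissible step exists. The function $g$ has a unique global minimizer $x_*$ on $C$, and every sequence $\{x_k\}$ generated by the method converges to $x_*$. Moreover, with $$\lambda:=\frac{b}{\sqrt b+b},\qquad t_*:=\frac{1+b-\sqrt{1-6b+b^2}}4,\qquad f(t):=\frac t{1-t}-2t+b\quad(0\le t<1),$$ one has $x_*\in W_{t_*}(x_0)$ and, for all $k\ge0$, $x_k\in W_\lambda(x_0)$, $$\|g''(x_0)^{-1}g'(x_k)\|_{x_0}\le\Big(\frac{1+\theta^2}2\Big)^k b,$$ $$\|x_*-x_{k+1}\|_{x_0}\le\Big[\frac{1+\theta}2\,\frac{D^-f'(\lambda)}{|f'(\lambda)|}\,\|x_*-x_k\|_{x_0}+\theta\,\frac{f'(\lambda)+2}{|f'(\lambda)|}\Big]\|x_*-x_k\|_{x_0},$$ where $D^-$ denotes the left derivative. If in addition $\theta<(1-2\sqrt b-b)/(5-2\sqrt b-b)$, then the convergence is $Q$-linear: for all $k\ge0$, $$\|x_*-x_{k+1}\|_{x_0}\le\Big[\frac{1+\theta}2+\frac{2\theta}{1-2\sqrt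 b-b}\Big]\|x_*-x_k\|_{x_0},$$ and the factor in brackets is less than $1$. -/

import Mathlib

open Set Filter Topology

/-- The Hessian `g''(x)`, as the derivative of the gradient. -/
noncomputable def hess {n : ℕ} (g : EuclideanSpace ℝ (Fin n) → ℝ)
    (x : EuclideanSpace ℝ (Fin n)) :
    EuclideanSpace ℝ (Fin n) →L[ℝ] EuclideanSpace ℝ (Fin n) :=
  fderiv ℝ (gradient g) x

/-- `g` is `a`-self-concordant on `C` (Nesterov and Nemirovskii): it is convex and three times
continuously differentiable on `C`, and
`|g'''(x)[h,h,h]| ≤ 2 a^(-1/2) (g''(x)[h,h])^(3/2)` for all `x ∈ C` and all `h`. -/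
structure IsSelfConcordantOn {n : ℕ} (a : ℝ) (C : Set (EuclideanSpace ℝ (Fin n)))
    (g : EuclideanSpace ℝ (Fin n) → ℝ) : Prop where
  contDiffOn : ContDiffOn ℝ 3 g C
  convexOn : ConvexOn ℝ C g
  third_le : ∀ x ∈ C, ∀ h : EuclideanSpace ℝ (Fin n),
    |iteratedFDeriv ℝ 3 g x (fun _ => h)| ≤
      2 * a ^ (-(1 / 2) : ℝ) * (inner ℝ h (hess g x h)) ^ (3 / 2 : ℝ)

/-- The local norm `‖v‖_x = (a⁻¹ vᵀ g''(x) v)^(1/2)` of an `a`-self-concordant function. -/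
noncomputable def localNorm {n : ℕ} (a : ℝ) (g : EuclideanSpace ℝ (Fin n) → ℝ)
    (x v : EuclideanSpace ℝ (Fin n)) : ℝ :=
  √(a⁻¹ * inner ℝ v (hess g x v))

/-- The open Dikin ellipsoid `W_r(x)`. -/
def dikin {n : ℕ} (a : ℝ) (g : EuclideanSpace ℝ (Fin n) → ℝ)
    (r : ℝ) (x : EuclideanSpace ℝ (Fin n)) : Set (EuclideanSpace ℝ (Fin n)) :=
  {z | localNorm a g x (z - x) < r}

/-- `‖g''(x₀)⁻¹ v‖_{x₀}`, the norm in which residuals are measured. -/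
noncomputable def residualNorm {n : ℕ} (a : ℝ) (g : EuclideanSpace ℝ (Fin n) → ℝ)
    (x₀ v : EuclideanSpace ℝ (Fin n)) : ℝ :=
  localNorm a g x₀ ((hess g x₀).inverse v)

/-- `s` is an admissible inexact Newton step for `g' = 0` at `y`, with relative residual
tolerance `θ` in the norm attached to `x₀`. -/
def IsInexactNewtonStep {n : ℕ} (a : ℝ) (g : EuclideanSpace ℝ (Fin n) → ℝ) (θ : ℝ)
    (x₀ y s : EuclideanSpace ℝ (Fin n)) : Prop :=
  residualNorm a g x₀ (gradient g y + hess g y s) ≤ θ * residualNorm a g x₀ (gradient g y)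

/-- The scalar function `f(t) = t / (1 - t) - 2 t + b`, considered on `[0, 1)`. -/
noncomputable def scMajorant (b t : ℝ) : ℝ := t / (1 - t) - 2 * t + b

/-!
The residual of the method at `x` is controlled by a scalar inexact Newton iteration for the
majorant `f(t) = t / (1 - t) - 2 t + b`, in the manner of Kantorovich's theorem.

Self-concordance bounds the third derivative on the diagonal. A symmetric trilinear form has the
same bound off the diagonal (`abs_trilinear_le`), so that along a line `x₀ + s u` the logarithm of
`g''[v, v]` has a derivative of size at most `2 ‖u‖` in the norm attached to the current point, and
that norm of `u` itself satisfies a differential inequality. Hence, in the Dikin ellipsoid and at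
distance `t` from `x₀`,
`(1 - t)² g''(x₀) ≤ g''(x) ≤ (1 - t)⁻² g''(x₀)` (`hessForm_line_le`, `le_hessForm_line`), while the
third derivative is at most `2 / (1 - t)³ = f''(t)`. Two integrations bound the linearization error
of `g'` by that of `f` (`linearization_error_le`). All estimates are tested against vectors: the
residual norm is the dual of the local norm at `x₀` (`residualNorm_le`).

An inexact Newton step therefore maps `{x : ‖x - x₀‖ ≤ t, residual ≤ f(t) + ε}` to the same set for
the pair `majorantStep b θ (t, ε)` (`IsInexactNewtonStep.majorized`). The scalar iteration keeps
`t < λ` and `ε ≤ κ t`, with `κ = -f'(λ)`, and multiplies `f(t) + ε` by at most `(1 + θ²) / 2`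
(`MajorantRegion.step`); this rests on the fact that the line of slope `-κ` through the origin is
tangent to the graph of `f` at `λ`.

The minimizer is obtained apart from the method. The lower bound for the Hessian makes the gradient
point outwards on the boundary of the ellipsoid of radius `t_*` (`exists_isMinOn`), so that `g` has
a minimizer inside, and it makes the gradient strongly monotone, which turns the decay of the
residuals into convergence. Both error bounds come from
`g''(x)(x_* - x - s) = -(g'(x) + g''(x) s) - E`, where `E` is the linearization error at `x_*`; the
linear rate uses moreover that `‖x_* - x_k‖ ≤ λ - t_k` (`localNorm_limit_sub_le`).
-/

/-! ### Derivatives along lines -/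

/-- The second derivative of `g` at `x` as a bilinear form, divided by `a`. For `u = v` this is
the square of `localNorm a g x u`. -/
noncomputable def hessForm {n : ℕ} (a : ℝ) (g : EuclideanSpace ℝ (Fin n) → ℝ)
    (x u v : EuclideanSpace ℝ (Fin n)) : ℝ :=
  a⁻¹ * inner ℝ u (hess g x v)

/-- The third derivative of `g` at `x` as a trilinear form, divided by `a`. -/
noncomputable def thirdForm {n : ℕ} (a : ℝ) (g : EuclideanSpace ℝ (Fin n) → ℝ)
    (x u v w : EuclideanSpace ℝ (Fin n)) : ℝ :=
  a⁻¹ * fderiv ℝ (fderiv ℝ (fderiv ℝ g)) x u v w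

section Calculus

variable {n : ℕ} {g : EuclideanSpace ℝ (Fin n) → ℝ} {C : Set (EuclideanSpace ℝ (Fin n))} {a : ℝ}
  {x : EuclideanSpace ℝ (Fin n)}

theorem hasDerivAt_line_of_differentiableAt {E F : Type*} [NormedAddCommGroup E]
    [NormedSpace ℝ E] [NormedAddCommGroup F] [NormedSpace ℝ F] {G : E → F} {x : E} (u : E)
    {t : ℝ} (hG : DifferentiableAt ℝ G (x + t • u)) :
    HasDerivAt (fun s : ℝ => G (x + s • u)) (fderiv ℝ G (x + t • u) u) t := by
  have h1 : HasDerivAt (fun s : ℝ => x + s • u) u t := by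
    simpa using ((hasDerivAt_id t).smul_const u).const_add x
  exact hG.hasFDerivAt.comp_hasDerivAt t h1

theorem differentiableAt_gradient (hg : ContDiffAt ℝ 3 g x) :
    DifferentiableAt ℝ (gradient g) x := by
  have h1 : DifferentiableAt ℝ (fderiv ℝ g) x :=
    (hg.fderiv_right (m := 2) (by norm_num)).differentiableAt (by norm_num)
  exact ((InnerProductSpace.toDual ℝ
    (EuclideanSpace ℝ (Fin n))).symm.toContinuousLinearEquiv.toContinuousLinearMap
      ).differentiableAt.comp x h1

theorem inner_hess (hg : ContDiffAt ℝ 3 g x) (u v : EuclideanSpace ℝ (Fin n)) :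
    inner ℝ u (hess g x v) = fderiv ℝ (fderiv ℝ g) x v u := by
  have h1 : DifferentiableAt ℝ (fderiv ℝ g) x :=
    (hg.fderiv_right (m := 2) (by norm_num)).differentiableAt (by norm_num)
  have h2 := (differentiableAt_gradient hg).hasFDerivAt
  have h3 : HasFDerivAt (fun y => inner ℝ u (gradient g y))
      ((innerSL ℝ u).comp (hess g x)) x := (innerSL ℝ u).hasFDerivAt.comp x h2
  have h4 : HasFDerivAt (fun y => fderiv ℝ g y u)
      ((ContinuousLinearMap.apply ℝ ℝ u).comp (fderiv ℝ (fderiv ℝ g) x)) x :=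
    (ContinuousLinearMap.apply ℝ ℝ u).hasFDerivAt.comp x h1.hasFDerivAt
  have h5 : (fun y => inner ℝ u (gradient g y)) = fun y => fderiv ℝ g y u := by
    funext y
    simp [inner_gradient_right]
  rw [h5] at h3
  simpa using congrArg (fun L => L v) (h3.unique h4)

theorem hessForm_symm (hg : ContDiffAt ℝ 3 g x) (u v : EuclideanSpace ℝ (Fin n)) :
    hessForm a g x u v = hessForm a g x v u := by
  rw [hessForm, hessForm, inner_hess hg, inner_hess hg,
    (hg.isSymmSndFDerivAt (by simp; norm_num)).eq]

theorem hasDerivAt_comp_line (u : EuclideanSpace ℝ (Fin n)) {t : ℝ}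
    (hg : ContDiffAt ℝ 3 g (x + t • u)) :
    HasDerivAt (fun s : ℝ => g (x + s • u)) (inner ℝ (gradient g (x + t • u)) u) t := by
  have h1 : HasDerivAt (fun s : ℝ => x + s • u) u t := by
    simpa using ((hasDerivAt_id t).smul_const u).const_add x
  have := (hg.differentiableAt (by norm_num)).hasFDerivAt.comp_hasDerivAt t h1
  rwa [inner_gradient_left]

theorem hasDerivAt_gradient_line (u v : EuclideanSpace ℝ (Fin n)) {t : ℝ}
    (hg : ContDiffAt ℝ 3 g (x + t • u)) :
    HasDerivAt (fun s : ℝ => a⁻¹ * inner ℝ v (gradient g (x + s • u)))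
      (hessForm a g (x + t • u) v u) t := by
  have h1 : HasDerivAt (fun s : ℝ => x + s • u) u t := by
    simpa using ((hasDerivAt_id t).smul_const u).const_add x
  have h2 := (differentiableAt_gradient hg).hasFDerivAt.comp_hasDerivAt t h1
  exact ((innerSL ℝ v).hasFDerivAt.comp_hasDerivAt t h2).const_mul a⁻¹

theorem hasDerivAt_hessForm_line (hC : IsOpen C) (hg : ContDiffOn ℝ 3 g C)
    (u v w : EuclideanSpace ℝ (Fin n)) {t : ℝ} (ht : x + t • u ∈ C) :
    HasDerivAt (fun s : ℝ => hessForm a g (x + s • u) v w)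
      (thirdForm a g (x + t • u) u w v) t := by
  have h1 : HasDerivAt (fun s : ℝ => x + s • u) u t := by
    simpa using ((hasDerivAt_id t).smul_const u).const_add x
  have hat := hg.contDiffAt (hC.mem_nhds ht)
  have h2 : DifferentiableAt ℝ (fderiv ℝ (fderiv ℝ g)) (x + t • u) :=
    ((hat.fderiv_right (m := 2) (by norm_num)).fderiv_right (m := 1)
      (by norm_num)).differentiableAt (by norm_num)
  have h3 := hasDerivAt_line_of_differentiableAt (F := EuclideanSpace ℝ (Fin n) →L[ℝ]
    EuclideanSpace ℝ (Fin n) →L[ℝ] ℝ) (G := fderiv ℝ (fderiv ℝ g)) u h2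
  have h4 := (ContinuousLinearMap.apply ℝ _ w).hasFDerivAt.comp_hasDerivAt t h3
  have h5 := ((ContinuousLinearMap.apply ℝ ℝ v).hasFDerivAt.comp_hasDerivAt t h4).const_mul a⁻¹
  refine HasDerivAt.congr_of_eventuallyEq h5 ?_
  filter_upwards [h1.continuousAt.preimage_mem_nhds (hC.mem_nhds ht)] with s hs
  rw [hessForm, inner_hess (hg.contDiffAt (hC.mem_nhds hs))]
  rfl

theorem thirdForm_swap_left (hg : ContDiffAt ℝ 3 g x) (u v w : EuclideanSpace ℝ (Fin n)) :
    thirdForm a g x u v w = thirdForm a g x v u w := by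
  have h := ((hg.fderiv_right (m := 2) (by norm_num)).isSymmSndFDerivAt (by simp)).eq u v
  rw [thirdForm, thirdForm, h]

theorem thirdForm_swap_right (hC : IsOpen C) (hg : ContDiffOn ℝ 3 g C) (hx : x ∈ C)
    (u v w : EuclideanSpace ℝ (Fin n)) :
    thirdForm a g x u v w = thirdForm a g x u w v := by
  have h1 := hasDerivAt_hessForm_line (a := a) (x := x) (t := 0) hC hg u w v (by simpa using hx)
  have h2 := hasDerivAt_hessForm_line (a := a) (x := x) (t := 0) hC hg u v w (by simpa using hx)
  have h3 : HasDerivAt (fun s : ℝ => hessForm a g (x + s • u) w v)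
      (thirdForm a g (x + (0 : ℝ) • u) u w v) 0 := by
    refine HasDerivAt.congr_of_eventuallyEq h2 ?_
    have h4 : Continuous fun s : ℝ => x + s • u := by fun_prop
    filter_upwards [h4.continuousAt.preimage_mem_nhds (hC.mem_nhds
      (show x + (0 : ℝ) • u ∈ C by simpa using hx))] with s hs
    exact hessForm_symm (hg.contDiffAt (hC.mem_nhds hs)) _ _
  simpa using h1.unique h3

theorem hessForm_self_nonneg (ha : 0 < a) (hC : IsOpen C) (hg : IsSelfConcordantOn a C g)
    (hx : x ∈ C) (u : EuclideanSpace ℝ (Fin n)) : 0 ≤ hessForm a g x u u := by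
  have hcont : Continuous fun s : ℝ => x + s • u := by fun_prop
  set S : Set ℝ := (fun s : ℝ => x + s • u) ⁻¹' C with hS
  have hSo : IsOpen S := hC.preimage hcont
  have hat : ∀ s ∈ S, ContDiffAt ℝ 3 g (x + s • u) := fun s hs =>
    hg.contDiffOn.contDiffAt (hC.mem_nhds hs)
  have hconv : ConvexOn ℝ S (fun s : ℝ => g (x + s • u)) := by
    have := hg.convexOn.comp_affineMap (AffineMap.lineMap x (x + u) : ℝ →ᵃ[ℝ] _)
    have e : ((AffineMap.lineMap x (x + u) : ℝ →ᵃ[ℝ] _) : ℝ → _) = fun s : ℝ => x + s • u := by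
      funext s
      simp [AffineMap.lineMap_apply, add_comm]
    rw [e] at this
    exact this
  have hmono := hconv.monotoneOn_deriv fun s hs =>
    (hasDerivAt_comp_line u (hat s hs)).differentiableAt
  have h0 : (0 : ℝ) ∈ S := by simpa [hS] using hx
  have hd : HasDerivAt (deriv fun s : ℝ => g (x + s • u))
      (a * hessForm a g (x + (0 : ℝ) • u) u u) 0 := by
    refine HasDerivAt.congr_of_eventuallyEq
      ((hasDerivAt_gradient_line (a := a) u u (hat 0 h0)).const_mul a) ?_
    filter_upwards [hSo.mem_nhds h0] with s hs
    rw [(hasDerivAt_comp_line u (hat s hs)).deriv, real_inner_comm]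
    field_simp
  have h1 : 0 ≤ a * hessForm a g (x + (0 : ℝ) • u) u u := by
    rw [← hd.hasDerivWithinAt.derivWithin (hSo.uniqueDiffWithinAt h0)]
    exact hmono.derivWithin_nonneg
  simpa using nonneg_of_mul_nonneg_right h1 ha

theorem localNorm_eq (a : ℝ) (g : EuclideanSpace ℝ (Fin n) → ℝ)
    (x v : EuclideanSpace ℝ (Fin n)) : localNorm a g x v = √(hessForm a g x v v) := rfl

theorem localNorm_nonneg (a : ℝ) (g : EuclideanSpace ℝ (Fin n) → ℝ)
    (x v : EuclideanSpace ℝ (Fin n)) : 0 ≤ localNorm a g x v := Real.sqrt_nonneg _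

theorem sq_localNorm (ha : 0 < a) (hC : IsOpen C) (hg : IsSelfConcordantOn a C g)
    (hx : x ∈ C) (u : EuclideanSpace ℝ (Fin n)) :
    localNorm a g x u ^ 2 = hessForm a g x u u :=
  Real.sq_sqrt (hessForm_self_nonneg ha hC hg hx u)

theorem abs_thirdForm_self_le (ha : 0 < a) (hC : IsOpen C) (hg : IsSelfConcordantOn a C g)
    (hx : x ∈ C) (u : EuclideanSpace ℝ (Fin n)) :
    |thirdForm a g x u u u| ≤ 2 * localNorm a g x u ^ 3 := by
  have h := hg.third_le x hx u
  have e : iteratedFDeriv ℝ 3 g x (fun _ => u) = fderiv ℝ (fderiv ℝ (fderiv ℝ g)) x u u u := by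
    rw [iteratedFDeriv_succ_apply_right, iteratedFDeriv_two_apply]
    rfl
  have hq := hessForm_self_nonneg ha hC hg hx u
  have hi : 0 ≤ inner ℝ u (hess g x u) := by
    have := mul_nonneg ha.le hq
    rwa [hessForm, mul_inv_cancel_left₀ ha.ne'] at this
  have e2 : localNorm a g x u ^ 3 = hessForm a g x u u ^ (3 / 2 : ℝ) := by
    rw [localNorm_eq, Real.sqrt_eq_rpow, ← Real.rpow_natCast, ← Real.rpow_mul hq]
    norm_num
  rw [e] at h
  rw [thirdForm, abs_mul, abs_of_pos (inv_pos.2 ha), e2, hessForm,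
    Real.mul_rpow (inv_pos.2 ha).le hi]
  calc a⁻¹ * |fderiv ℝ (fderiv ℝ (fderiv ℝ g)) x u u u| ≤ a⁻¹ *
        (2 * a ^ (-(1 / 2) : ℝ) * (inner ℝ u (hess g x u)) ^ (3 / 2 : ℝ)) := by gcongr
    _ = _ := by
      have : a⁻¹ ^ (3 / 2 : ℝ) = a⁻¹ * a ^ (-(1 / 2) : ℝ) := by
        rw [Real.inv_rpow ha.le, ← Real.rpow_neg ha.le, ← Real.rpow_neg_one a,
          ← Real.rpow_add ha]
        norm_num
      rw [this]
      ring

end Calculus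

/-! ### Polarization of a cubic form -/

/-- A convex combination of three values of a binary cubic form, taken at unit vectors at angles
`2π/3` from each other. It is the inequality behind `abs_trilinear_le`: the coefficients
`(4 cos² - 1)² / 9` are nonnegative with sum `1`, and the angle `θ` of the first vector is chosen
such that the combination is the value at `3θ` of the polarized form. -/
theorem abs_cos_mul_add_sin_mul_le {p q r w M ω : ℝ}
    (h : ∀ c s : ℝ, c ^ 2 + s ^ 2 = 1 →
      |c ^ 3 * p + 3 * c ^ 2 * s * q + 3 * c * s ^ 2 * r + s ^ 3 * w| ≤ M) :
    |Real.cos ω * p + Real.sin ω * q| ≤ M := by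
  obtain ⟨θ, rfl⟩ : ∃ θ, ω = 3 * θ := ⟨ω / 3, by ring⟩
  rw [Real.cos_three_mul, Real.sin_three_mul]
  have hcs := Real.cos_sq_add_sin_sq θ
  set c := Real.cos θ
  set s := Real.sin θ
  have hk : √3 ^ 2 = (3 : ℝ) := Real.sq_sqrt (by norm_num)
  set k := √(3 : ℝ)
  have h4 : k ^ 4 = 9 := by rw [show k ^ 4 = (k ^ 2) ^ 2 by ring, hk]; norm_num
  have h6 : k ^ 6 = 27 := by rw [show k ^ 6 = (k ^ 2) ^ 3 by ring, hk]; norm_num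
  -- the rotations of `(c, s)` by `±2π/3`, with `k = √3`
  have h1 := h c s hcs
  have h2 := h (-c / 2 - k * s / 2) (k * c / 2 - s / 2)
    (by linear_combination hcs + (c ^ 2 + s ^ 2) / 4 * hk)
  have h3 := h (-c / 2 + k * s / 2) (-k * c / 2 - s / 2)
    (by linear_combination hcs + (c ^ 2 + s ^ 2) / 4 * hk)
  have hsum : (3 * c ^ 2 - s ^ 2) ^ 2 / 9 +
      (3 * (-c / 2 - k * s / 2) ^ 2 - (k * c / 2 - s / 2) ^ 2) ^ 2 / 9 +
      (3 * (-c / 2 + k * s / 2) ^ 2 - (-k * c / 2 - s / 2) ^ 2) ^ 2 / 9 = 1 := by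
    trans (c ^ 2 + s ^ 2) ^ 2
    · ring_nf
      simp only [hk, h4]
      ring
    · rw [hcs]; norm_num
  have hid : (4 * c ^ 3 - 3 * c) * p + (3 * s - 4 * s ^ 3) * q =
      (3 * c ^ 2 - s ^ 2) ^ 2 / 9 *
        (c ^ 3 * p + 3 * c ^ 2 * s * q + 3 * c * s ^ 2 * r + s ^ 3 * w) +
      (3 * (-c / 2 - k * s / 2) ^ 2 - (k * c / 2 - s / 2) ^ 2) ^ 2 / 9 *
        ((-c / 2 - k * s / 2) ^ 3 * p + 3 * (-c / 2 - k * s / 2) ^ 2 * (k * c / 2 - s / 2) * q +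
          3 * (-c / 2 - k * s / 2) * (k * c / 2 - s / 2) ^ 2 * r + (k * c / 2 - s / 2) ^ 3 * w) +
      (3 * (-c / 2 + k * s / 2) ^ 2 - (-k * c / 2 - s / 2) ^ 2) ^ 2 / 9 *
        ((-c / 2 + k * s / 2) ^ 3 * p + 3 * (-c / 2 + k * s / 2) ^ 2 * (-k * c / 2 - s / 2) * q +
          3 * (-c / 2 + k * s / 2) * (-k * c / 2 - s / 2) ^ 2 * r +
          (-k * c / 2 - s / 2) ^ 3 * w) := by
    trans (c ^ 2 + s ^ 2) ^ 2 *
      ((c ^ 3 - 3 * c * s ^ 2) * p + (3 * c ^ 2 * s - s ^ 3) * q)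
    · rw [hcs]
      linear_combination (3 * c * p - 3 * s * q) * hcs
    · ring_nf
      simp only [hk, h4, h6]
      ring
  rw [hid]
  rw [abs_le] at h1 h2 h3 ⊢
  have n1 : 0 ≤ (3 * c ^ 2 - s ^ 2) ^ 2 / 9 := by positivity
  have n2 : 0 ≤ (3 * (-c / 2 - k * s / 2) ^ 2 - (k * c / 2 - s / 2) ^ 2) ^ 2 / 9 := by positivity
  have n3 : 0 ≤ (3 * (-c / 2 + k * s / 2) ^ 2 - (-k * c / 2 - s / 2) ^ 2) ^ 2 / 9 := by positivity
  have l1 := mul_le_mul_of_nonneg_left h1.1 n1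
  have l2 := mul_le_mul_of_nonneg_left h2.1 n2
  have l3 := mul_le_mul_of_nonneg_left h3.1 n3
  have u1 := mul_le_mul_of_nonneg_left h1.2 n1
  have u2 := mul_le_mul_of_nonneg_left h2.2 n2
  have u3 := mul_le_mul_of_nonneg_left h3.2 n3
  have hsM := congrArg (· * M) hsum
  simp only [add_mul, one_mul] at hsM
  constructor <;> linarith

section Trilinear

variable {V : Type*} [AddCommGroup V] [Module ℝ V] {B : V → V → ℝ} {T : V → V → V → ℝ} {M : ℝ}

theorem abs_trilinear_le_of_unit
    (hB : ∀ (c d : ℝ) (u v w : V), B (c • u + d • v) w = c * B u w + d * B v w)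
    (hBs : ∀ u v, B u v = B v u) (hBp : ∀ v, v ≠ 0 → 0 < B v v)
    (hT : ∀ (c d : ℝ) (u v w z : V), T (c • u + d • v) w z = c * T u w z + d * T v w z)
    (hT₁ : ∀ u v w, T u v w = T v u w) (hT₂ : ∀ u v w, T u v w = T u w v)
    (h : ∀ v, B v v = 1 → |T v v v| ≤ M) {u v : V} (hu : B u u = 1) (hv : B v v = 1) :
    |T u v v| ≤ M := by
  have hB' : ∀ (c d : ℝ) (u v w : V), B w (c • u + d • v) = c * B w u + d * B w v := by
    intro c d u v w
    rw [hBs, hB, hBs u, hBs v]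
  have hT' : ∀ (c d : ℝ) (u v w z : V), T w (c • u + d • v) z = c * T w u z + d * T w v z := by
    intro c d u v w z
    rw [hT₁, hT, hT₁ u, hT₁ v]
  have hT'' : ∀ (c d : ℝ) (u v w z : V), T w z (c • u + d • v) = c * T w z u + d * T w z v := by
    intro c d u v w z
    rw [hT₂, hT', hT₂ w u, hT₂ w v]
  set β := B u v with hβ
  -- the component of `u` orthogonal to `v`
  set z := (1 : ℝ) • u + (-β) • v with hz
  have hzz : B z z = 1 - β ^ 2 := by
    rw [hz, hB, hB', hB', hBs v u, hu, hv, ← hβ]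
    ring
  by_cases hz0 : z = 0
  · have hu' : u = β • v + (0 : ℝ) • v := by
      rw [hz, one_smul, neg_smul, add_neg_eq_zero] at hz0
      rw [zero_smul, add_zero]
      exact hz0
    have hβ2 : β ^ 2 = 1 := by
      have h0 : B z z = 0 := by
        have := hB 0 0 z z z
        simpa [hz0] using this
      linarith
    have hTu : T u v v = β * T v v v := by
      conv_lhs => rw [hu', hT]
      ring
    rw [hTu, abs_mul, ← Real.sqrt_sq_eq_abs β, hβ2, Real.sqrt_one, one_mul]
    exact h v hv
  · have hpos : 0 < 1 - β ^ 2 := hzz ▸ hBp z hz0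
    set σ := √(1 - β ^ 2) with hσ
    have hσ0 : 0 < σ := Real.sqrt_pos.2 hpos
    have hσ2 : σ ^ 2 = 1 - β ^ 2 := Real.sq_sqrt hpos.le
    obtain ⟨e, he⟩ : ∃ e, e = σ⁻¹ • z + (0 : ℝ) • z := ⟨_, rfl⟩
    have hez : u = β • v + σ • e := by
      rw [he, zero_smul, add_zero, smul_inv_smul₀ hσ0.ne', hz]
      module
    have hzv : B z v = 0 := by
      rw [hz, hB, hv, ← hβ]
      ring
    have hev : B e v = 0 := by
      rw [he, hB, hzv]
      ring
    have hee : B e e = 1 := by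
      rw [he, hB, hB', hzz, ← hσ2]
      field_simp
      ring
    have hang := abs_cos_mul_add_sin_mul_le (p := T v v v) (q := T e v v) (r := T e e v)
      (w := T e e e) (M := M) (ω := Real.arccos β) (by
        intro c s hcs
        have h1 := h (c • v + s • e) (by
          rw [hB, hB', hB', hBs v e, hev, hee, hv]
          linear_combination hcs)
        have h2 : T (c • v + s • e) (c • v + s • e) (c • v + s • e) =
            c ^ 3 * T v v v + 3 * c ^ 2 * s * T e v v + 3 * c * s ^ 2 * T e e v +
              s ^ 3 * T e e e := by
          simp only [hT, hT', hT'']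
          rw [hT₁ v e v, hT₂ v v e, hT₁ v e v, hT₁ v e e, hT₂ e v e]
          ring
        rwa [h2] at h1)
    have hβle : β ^ 2 ≤ 1 := by linarith
    rw [Real.cos_arccos (by nlinarith) (by nlinarith), Real.sin_arccos, ← hσ] at hang
    have : T u v v = β * T v v v + σ * T e v v := by
      conv_lhs => rw [hez, hT]
    rwa [this]

/-- Banach's polarization inequality for a symmetric trilinear form: its bound on the diagonal by
the cube of a Euclidean norm holds, with the same constant, off the diagonal. -/
theorem abs_trilinear_le
    (hB : ∀ (c d : ℝ) (u v w : V), B (c • u + d • v) w = c * B u w + d * B v w)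
    (hBs : ∀ u v, B u v = B v u) (hBp : ∀ v, v ≠ 0 → 0 < B v v)
    (hT : ∀ (c d : ℝ) (u v w z : V), T (c • u + d • v) w z = c * T u w z + d * T v w z)
    (hT₁ : ∀ u v w, T u v w = T v u w) (hT₂ : ∀ u v w, T u v w = T u w v)
    (h : ∀ v, |T v v v| ≤ M * √(B v v) ^ 3) (u v : V) :
    |T u v v| ≤ M * √(B u u) * √(B v v) ^ 2 := by
  have hTs : ∀ (c : ℝ) (u v w : V), T (c • u) v w = c * T u v w := by
    intro c u v w
    simpa using hT c 0 u u v w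
  have hBs1 : ∀ (c : ℝ) (u v : V), B (c • u) v = c * B u v := by
    intro c u v
    simpa using hB c 0 u u v
  have hT0 : ∀ v w, T 0 v w = 0 := by
    intro v w
    simpa using hTs 0 0 v w
  have hB0 : B 0 0 = 0 := by simpa using hBs1 0 0 0
  by_cases hu : u = 0
  · simp [hu, hT0, hB0]
  by_cases hv : v = 0
  · simp [hv, hT₁ u 0, hT0, hB0]
  have norm_one : ∀ w : V, w ≠ 0 → B ((√(B w w))⁻¹ • w) ((√(B w w))⁻¹ • w) = 1 := by
    intro w hw
    have h1 := Real.sqrt_pos.2 (hBp w hw)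
    rw [hBs1, hBs w (_ • w), hBs1]
    field_simp
    exact (Real.sq_sqrt (hBp w hw).le).symm
  have key := abs_trilinear_le_of_unit (M := M) hB hBs hBp hT hT₁ hT₂ (fun w hw => by
    simpa [hw] using h w) (norm_one u hu) (norm_one v hv)
  have h1 := Real.sqrt_pos.2 (hBp u hu)
  have h2 := Real.sqrt_pos.2 (hBp v hv)
  rw [hTs, hT₁, hTs, hT₂, hT₁, hTs, hT₂ v v u, hT₁ v u v,
    abs_mul, abs_mul, abs_mul, abs_of_pos (inv_pos.2 h1), abs_of_pos (inv_pos.2 h2)] at key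
  have h3 : |T u v v| = √(B u u) * √(B v v) ^ 2 *
      ((√(B u u))⁻¹ * ((√(B v v))⁻¹ * ((√(B v v))⁻¹ * |T u v v|))) := by
    field_simp
  rw [h3]
  calc _ ≤ √(B u u) * √(B v v) ^ 2 * M := by gcongr
    _ = _ := by ring

end Trilinear

section SelfConcordant

variable {n : ℕ} {g : EuclideanSpace ℝ (Fin n) → ℝ} {C : Set (EuclideanSpace ℝ (Fin n))} {a : ℝ}
  {x : EuclideanSpace ℝ (Fin n)}

/-- The Hessian need not be positive definite, so that `abs_trilinear_le` is applied to
`g''(x) + η I` for small `η > 0`. -/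
theorem abs_thirdForm_le (ha : 0 < a) (hC : IsOpen C) (hg : IsSelfConcordantOn a C g)
    (hx : x ∈ C) (u v : EuclideanSpace ℝ (Fin n)) :
    |thirdForm a g x u v v| ≤ 2 * localNorm a g x u * localNorm a g x v ^ 2 := by
  have hat := hg.contDiffOn.contDiffAt (hC.mem_nhds hx)
  have key : ∀ η : ℝ, 0 < η → |thirdForm a g x u v v| ≤
      2 * √(hessForm a g x u u + η * inner ℝ u u) *
        √(hessForm a g x v v + η * inner ℝ v v) ^ 2 := by
    intro η hη
    refine abs_trilinear_le (B := fun u v => hessForm a g x u v + η * inner ℝ u v)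
      (T := thirdForm a g x) ?_ ?_ ?_ ?_ ?_ ?_ ?_ u v
    · intro c d u v w
      simp only [hessForm, inner_add_left, real_inner_smul_left]
      ring
    · intro u v
      rw [hessForm_symm hat, real_inner_comm]
    · intro v hv
      have h1 := hessForm_self_nonneg ha hC hg hx v
      have h2 : 0 < inner ℝ v v := real_inner_self_pos.2 hv
      positivity
    · intro c d u v w z
      simp only [thirdForm, map_add, map_smul, add_apply,
        smul_apply, smul_eq_mul]
      ring
    · exact thirdForm_swap_left hat
    · exact thirdForm_swap_right hC hg.contDiffOn hx
    · intro v
      refine (abs_thirdForm_self_le ha hC hg hx v).trans ?_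
      rw [localNorm_eq]
      gcongr
      have h2 : 0 ≤ inner ℝ v v := real_inner_self_nonneg
      nlinarith
  have hlim : Tendsto (fun η : ℝ => 2 * √(hessForm a g x u u + η * inner ℝ u u) *
        √(hessForm a g x v v + η * inner ℝ v v) ^ 2) (𝓝[>] 0)
      (𝓝 (2 * √(hessForm a g x u u + 0 * inner ℝ u u) *
        √(hessForm a g x v v + 0 * inner ℝ v v) ^ 2)) :=
    (Continuous.tendsto (by fun_prop) 0).mono_left nhdsWithin_le_nhds
  have := ge_of_tendsto hlim (eventually_nhdsWithin_of_forall fun η hη => key η hη)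
  simpa [localNorm_eq] using this

end SelfConcordant

/-! ### Comparison of derivatives on an interval -/

theorem le_of_hasDerivAt_nonneg {f f' : ℝ → ℝ} {s t : ℝ} (hst : s ≤ t)
    (hf : ∀ τ ∈ Icc s t, HasDerivAt f (f' τ) τ) (hf' : ∀ τ ∈ Icc s t, 0 ≤ f' τ) : f s ≤ f t := by
  refine monotoneOn_of_hasDerivWithinAt_nonneg (convex_Icc s t)
    (fun τ hτ => (hf τ hτ).continuousAt.continuousWithinAt)
    (fun τ hτ => (hf τ (interior_subset hτ)).hasDerivWithinAt)
    (fun τ hτ => hf' τ (interior_subset hτ)) (left_mem_Icc.2 hst) (right_mem_Icc.2 hst) hst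

/-- The first-order Taylor remainders of two functions are ordered like their second
derivatives. -/
theorem taylor_remainder_le {f f₁ f₂ k k₁ k₂ : ℝ → ℝ}
    (hf : ∀ τ ∈ Icc (0 : ℝ) 1, HasDerivAt f (f₁ τ) τ)
    (hf₁ : ∀ τ ∈ Icc (0 : ℝ) 1, HasDerivAt f₁ (f₂ τ) τ)
    (hk : ∀ τ ∈ Icc (0 : ℝ) 1, HasDerivAt k (k₁ τ) τ)
    (hk₁ : ∀ τ ∈ Icc (0 : ℝ) 1, HasDerivAt k₁ (k₂ τ) τ)
    (h : ∀ τ ∈ Icc (0 : ℝ) 1, f₂ τ ≤ k₂ τ) :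
    f 1 - f 0 - f₁ 0 ≤ k 1 - k 0 - k₁ 0 := by
  have h1 : ∀ τ ∈ Icc (0 : ℝ) 1, k₁ 0 - f₁ 0 ≤ k₁ τ - f₁ τ := fun τ hτ =>
    le_of_hasDerivAt_nonneg hτ.1
      (fun σ hσ => (hk₁ σ ⟨hσ.1, hσ.2.trans hτ.2⟩).sub (hf₁ σ ⟨hσ.1, hσ.2.trans hτ.2⟩))
      (fun σ hσ => sub_nonneg.2 (h σ ⟨hσ.1, hσ.2.trans hτ.2⟩))
  have h2 := le_of_hasDerivAt_nonneg (f := fun τ => k τ - f τ - τ * (k₁ 0 - f₁ 0))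
    (zero_le_one' ℝ)
    (fun τ hτ => ((hk τ hτ).sub (hf τ hτ)).sub ((hasDerivAt_id τ).mul_const (k₁ 0 - f₁ 0)))
    (fun τ hτ => by have := h1 τ hτ; linarith)
  linarith

section SelfConcordant

variable {n : ℕ} {g : EuclideanSpace ℝ (Fin n) → ℝ} {C : Set (EuclideanSpace ℝ (Fin n))} {a : ℝ}
  {x x₀ : EuclideanSpace ℝ (Fin n)}

/-! ### The local norm -/

theorem abs_hessForm_le (ha : 0 < a) (hC : IsOpen C) (hg : IsSelfConcordantOn a C g)
    (hx : x ∈ C) (u v : EuclideanSpace ℝ (Fin n)) :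
    |hessForm a g x u v| ≤ localNorm a g x u * localNorm a g x v := by
  let B : LinearMap.BilinForm ℝ (EuclideanSpace ℝ (Fin n)) :=
    LinearMap.mk₂ ℝ (hessForm a g x) (by simp [hessForm, inner_add_left, mul_add])
      (by intros; simp only [hessForm, real_inner_smul_left, smul_eq_mul]; ring)
      (by simp [hessForm, inner_add_right, mul_add])
      (by intros; simp only [hessForm, map_smul, real_inner_smul_right, smul_eq_mul]; ring)
  have h := B.apply_sq_le_of_symm (hessForm_self_nonneg ha hC hg hx)
    ⟨fun u v => hessForm_symm (hg.contDiffOn.contDiffAt (hC.mem_nhds hx)) u v⟩ u v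
  refine abs_le_of_sq_le_sq ?_
    (mul_nonneg (localNorm_nonneg a g x u) (localNorm_nonneg a g x v))
  rw [mul_pow, sq_localNorm ha hC hg hx, sq_localNorm ha hC hg hx]
  exact h

theorem localNorm_smul (a : ℝ) (g : EuclideanSpace ℝ (Fin n) → ℝ)
    (x : EuclideanSpace ℝ (Fin n)) (c : ℝ) (v : EuclideanSpace ℝ (Fin n)) :
    localNorm a g x (c • v) = |c| * localNorm a g x v := by
  have h : hessForm a g x (c • v) (c • v) = c ^ 2 * hessForm a g x v v := by
    simp only [hessForm, map_smul, real_inner_smul_left, real_inner_smul_right]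
    ring
  rw [localNorm_eq, localNorm_eq, h, Real.sqrt_mul (sq_nonneg c), Real.sqrt_sq_eq_abs]

theorem localNorm_neg (a : ℝ) (g : EuclideanSpace ℝ (Fin n) → ℝ)
    (x v : EuclideanSpace ℝ (Fin n)) : localNorm a g x (-v) = localNorm a g x v := by
  simpa using localNorm_smul a g x (-1) v

theorem localNorm_zero (a : ℝ) (g : EuclideanSpace ℝ (Fin n) → ℝ)
    (x : EuclideanSpace ℝ (Fin n)) : localNorm a g x 0 = 0 := by
  simpa using localNorm_smul a g x 0 0

theorem localNorm_add_le (ha : 0 < a) (hC : IsOpen C) (hg : IsSelfConcordantOn a C g)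
    (hx : x ∈ C) (u v : EuclideanSpace ℝ (Fin n)) :
    localNorm a g x (u + v) ≤ localNorm a g x u + localNorm a g x v := by
  have h0 := hessForm_symm (a := a) (hg.contDiffOn.contDiffAt (hC.mem_nhds hx)) v u
  have h : hessForm a g x (u + v) (u + v) =
      hessForm a g x u u + 2 * hessForm a g x u v + hessForm a g x v v := by
    have : hessForm a g x (u + v) (u + v) = hessForm a g x u u + hessForm a g x u v +
        hessForm a g x v u + hessForm a g x v v := by
      simp only [hessForm, map_add, inner_add_left, inner_add_right]
      ring
    rw [this, h0]
    ring
  have hu := localNorm_nonneg a g x u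
  have hv := localNorm_nonneg a g x v
  refine abs_le_of_sq_le_sq' ?_ (by positivity) |>.2
  rw [sq_localNorm ha hC hg hx, h, ← sq_localNorm ha hC hg hx, ← sq_localNorm ha hC hg hx]
  linarith [le_of_abs_le (abs_hessForm_le ha hC hg hx u v)]

theorem continuous_localNorm (a : ℝ) (g : EuclideanSpace ℝ (Fin n) → ℝ)
    (x : EuclideanSpace ℝ (Fin n)) : Continuous (localNorm a g x) := by
  unfold localNorm
  fun_prop

theorem convex_localNorm_le (ha : 0 < a) (hC : IsOpen C) (hg : IsSelfConcordantOn a C g)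
    (hx : x ∈ C) (r : ℝ) : Convex ℝ {z | localNorm a g x (z - x) ≤ r} := by
  intro u hu v hv c d hc hd hcd
  have e : c • u + d • v - x = c • (u - x) + d • (v - x) := by
    have : x = (c + d) • x := by rw [hcd, one_smul]
    nth_rewrite 1 [this]
    module
  rw [mem_ofPred_eq] at hu hv ⊢
  rw [e]
  refine (localNorm_add_le ha hC hg hx _ _).trans ?_
  rw [localNorm_smul, localNorm_smul, abs_of_nonneg hc, abs_of_nonneg hd]
  calc _ ≤ c * r + d * r := by gcongr
    _ = r := by rw [← add_mul, hcd, one_mul]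

/-! ### The Hessian in the Dikin ellipsoid -/

/-- The function `s ↦ 1 / ‖u‖` with the norm taken at `x + s u` is `1`-Lipschitz along the line.
As this norm may vanish, it is replaced by `√(‖u‖² + η²)`, and `η` tends to `0`. -/
theorem localNorm_line_le (ha : 0 < a) (hC : IsOpen C) (hg : IsSelfConcordantOn a C g)
    (u : EuclideanSpace ℝ (Fin n)) {t : ℝ} (ht : 0 ≤ t) (hseg : ∀ s ∈ Icc 0 t, x + s • u ∈ C) :
    localNorm a g (x + t • u) u * (1 - localNorm a g x u * t) ≤ localNorm a g x u := by
  have key : ∀ η : ℝ, 0 < η →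
      √(hessForm a g (x + t • u) u u + η ^ 2) * (1 - √(hessForm a g x u u + η ^ 2) * t) ≤
        √(hessForm a g x u u + η ^ 2) := by
    intro η hη
    have hpos : ∀ s ∈ Icc 0 t, 0 < hessForm a g (x + s • u) u u + η ^ 2 := fun s hs =>
      add_pos_of_nonneg_of_pos (hessForm_self_nonneg ha hC hg (hseg s hs) u) (by positivity)
    have hd : ∀ s ∈ Icc 0 t, HasDerivAt
        (fun s : ℝ => (√(hessForm a g (x + s • u) u u + η ^ 2))⁻¹ + s)
        (-(thirdForm a g (x + s • u) u u u / (2 * √(hessForm a g (x + s • u) u u + η ^ 2))) /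
          √(hessForm a g (x + s • u) u u + η ^ 2) ^ 2 + 1) s := fun s hs =>
      ((((hasDerivAt_hessForm_line hC hg.contDiffOn u u u (hseg s hs)).add_const (η ^ 2)).sqrt
        (hpos s hs).ne').inv (Real.sqrt_pos.2 (hpos s hs)).ne').add (hasDerivAt_id s)
    have hmono := le_of_hasDerivAt_nonneg ht hd (by
      intro s hs
      have h1 := Real.sqrt_pos.2 (hpos s hs)
      have h2 : localNorm a g (x + s • u) u ≤ √(hessForm a g (x + s • u) u u + η ^ 2) := by
        rw [localNorm_eq]
        exact Real.sqrt_le_sqrt (by nlinarith)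
      have h3 := abs_thirdForm_self_le ha hC hg (hseg s hs) u
      have h4 : thirdForm a g (x + s • u) u u u ≤
          2 * √(hessForm a g (x + s • u) u u + η ^ 2) ^ 3 :=
        (le_abs_self _).trans (h3.trans (by
          have := localNorm_nonneg a g (x + s • u) u
          gcongr))
      set R := √(hessForm a g (x + s • u) u u + η ^ 2)
      rw [neg_div, neg_add_eq_sub, sub_nonneg, div_div, div_le_one (by positivity)]
      linarith)
    have h1 := Real.sqrt_pos.2 (hpos t ⟨ht, le_rfl⟩)
    have h2 := Real.sqrt_pos.2 (hpos 0 ⟨le_rfl, ht⟩)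
    simp only [zero_smul, add_zero] at hmono h2
    set P := √(hessForm a g (x + t • u) u u + η ^ 2)
    set R := √(hessForm a g x u u + η ^ 2)
    have h3 := mul_le_mul_of_nonneg_left hmono (mul_pos h1 h2).le
    have h4 : P * R * R⁻¹ = P := by field_simp
    have h5 : P * R * (P⁻¹ + t) = R + P * R * t := by field_simp
    rw [h4, h5] at h3
    linarith
  have hlim : Tendsto (fun η : ℝ => √(hessForm a g x u u + η ^ 2) -
      √(hessForm a g (x + t • u) u u + η ^ 2) * (1 - √(hessForm a g x u u + η ^ 2) * t)) (𝓝[>] 0)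
      (𝓝 (√(hessForm a g x u u + 0 ^ 2) - √(hessForm a g (x + t • u) u u + 0 ^ 2) *
        (1 - √(hessForm a g x u u + 0 ^ 2) * t))) :=
    (Continuous.tendsto (by fun_prop) 0).mono_left nhdsWithin_le_nhds
  have := ge_of_tendsto hlim
    (eventually_nhdsWithin_of_forall fun η hη => sub_nonneg.2 (key η hη))
  simpa [localNorm_eq] using this

theorem abs_thirdForm_line_le (ha : 0 < a) (hC : IsOpen C) (hg : IsSelfConcordantOn a C g)
    (u v : EuclideanSpace ℝ (Fin n)) {t : ℝ} (ht : 0 ≤ t) (hut : localNorm a g x u * t < 1)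
    (hseg : ∀ s ∈ Icc 0 t, x + s • u ∈ C) :
    |thirdForm a g (x + t • u) u v v| * (1 - localNorm a g x u * t) ≤
      2 * localNorm a g x u * hessForm a g (x + t • u) v v := by
  have hx := hseg t ⟨ht, le_rfl⟩
  have h1 := abs_thirdForm_le ha hC hg hx u v
  rw [sq_localNorm ha hC hg hx] at h1
  have h2 := localNorm_line_le ha hC hg u ht hseg
  have h3 := hessForm_self_nonneg ha hC hg hx v
  calc _ ≤ (2 * localNorm a g (x + t • u) u * hessForm a g (x + t • u) v v) *
        (1 - localNorm a g x u * t) := by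
        have : 0 ≤ 1 - localNorm a g x u * t := by linarith
        gcongr
    _ = 2 * (localNorm a g (x + t • u) u * (1 - localNorm a g x u * t)) *
        hessForm a g (x + t • u) v v := by ring
    _ ≤ _ := by gcongr

/-- By `abs_thirdForm_line_le`, `g''[v, v] (1 - r s) ^ 2` decreases along the line `x + s u`, where
`r` is the norm of `u` at `x`. -/
theorem hessForm_line_le (ha : 0 < a) (hC : IsOpen C) (hg : IsSelfConcordantOn a C g)
    (u v : EuclideanSpace ℝ (Fin n)) {t : ℝ} (ht : 0 ≤ t) (hut : localNorm a g x u * t < 1)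
    (hseg : ∀ s ∈ Icc 0 t, x + s • u ∈ C) :
    hessForm a g (x + t • u) v v * (1 - localNorm a g x u * t) ^ 2 ≤ hessForm a g x v v := by
  have hu := localNorm_nonneg a g x u
  have h := le_of_hasDerivAt_nonneg
    (f := fun s => -(hessForm a g (x + s • u) v v * (1 - localNorm a g x u * s) ^ 2)) ht
    (fun s hs => ((hasDerivAt_hessForm_line hC hg.contDiffOn u v v (hseg s hs)).mul
      ((((hasDerivAt_id s).const_mul (localNorm a g x u)).const_sub 1).pow 2)).neg) (by
    intro s hs
    have hus : localNorm a g x u * s < 1 :=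
      (mul_le_mul_of_nonneg_left hs.2 hu).trans_lt hut
    have h1 := abs_thirdForm_line_le ha hC hg u v hs.1 hus
      (fun τ hτ => hseg τ ⟨hτ.1, hτ.2.trans hs.2⟩)
    have h2 := le_abs_self (thirdForm a g (x + s • u) u v v)
    have h3 : 0 ≤ 1 - localNorm a g x u * s := by linarith
    have h4 := mul_le_mul_of_nonneg_right h2 h3
    simp only [id, Pi.pow_apply, Nat.cast_ofNat, show (2 - 1 : ℕ) = 1 from rfl, pow_one, mul_one]
    nlinarith [mul_le_mul_of_nonneg_right (h4.trans h1) h3])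
  simp only [zero_smul, add_zero, mul_zero, sub_zero, one_pow, mul_one] at h
  linarith

/-- By `abs_thirdForm_line_le`, `g''[v, v] / (1 - r s) ^ 2` increases along the line `x + s u`,
where
`r` is the norm of `u` at `x`. -/
theorem le_hessForm_line (ha : 0 < a) (hC : IsOpen C) (hg : IsSelfConcordantOn a C g)
    (u v : EuclideanSpace ℝ (Fin n)) {t : ℝ} (ht : 0 ≤ t) (hut : localNorm a g x u * t < 1)
    (hseg : ∀ s ∈ Icc 0 t, x + s • u ∈ C) :
    hessForm a g x v v * (1 - localNorm a g x u * t) ^ 2 ≤ hessForm a g (x + t • u) v v := by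
  have hu := localNorm_nonneg a g x u
  have hlt : ∀ s ∈ Icc 0 t, 0 < 1 - localNorm a g x u * s := fun s hs => by
    have := mul_le_mul_of_nonneg_left hs.2 hu
    linarith
  have h := le_of_hasDerivAt_nonneg
    (f := fun s => hessForm a g (x + s • u) v v / (1 - localNorm a g x u * s) ^ 2) ht
    (fun s hs => (hasDerivAt_hessForm_line hC hg.contDiffOn u v v (hseg s hs)).div
      ((((hasDerivAt_id s).const_mul (localNorm a g x u)).const_sub 1).pow 2)
      (pow_pos (hlt s hs) 2).ne') (by
    intro s hs
    have h3 := hlt s hs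
    have h1 := abs_thirdForm_line_le ha hC hg u v hs.1 (by linarith)
      (fun τ hτ => hseg τ ⟨hτ.1, hτ.2.trans hs.2⟩)
    have h2 := neg_abs_le (thirdForm a g (x + s • u) u v v)
    have h4 := mul_le_mul_of_nonneg_right h2 h3.le
    refine div_nonneg ?_ (by positivity)
    simp only [id, Pi.pow_apply, Nat.cast_ofNat, show (2 - 1 : ℕ) = 1 from rfl, pow_one, mul_one]
    have h5 : 0 ≤ (2 * localNorm a g x u * hessForm a g (x + s • u) v v +
      thirdForm a g (x + s • u) u v v * (1 - localNorm a g x u * s)) := by linarith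
    nlinarith [mul_nonneg h5 h3.le])
  simp only [zero_smul, add_zero, mul_zero, sub_zero, one_pow, div_one] at h
  rwa [le_div_iff₀ (pow_pos (hlt t ⟨ht, le_rfl⟩) 2)] at h

/-- If the sublevel sets are closed, then `g` cannot stay bounded on approach to a boundary point
of its domain. Along a segment from `x` shorter than `1` in the norm attached to `x`, the second
derivative of `g` is bounded, and so is `g`; hence the segment cannot leave `C`. -/
theorem dikin_one_subset (ha : 0 < a) (hC : IsOpen C) (hCc : Convex ℝ C)
    (hg : IsSelfConcordantOn a C g) (hx : x ∈ C)
    (hdom : ∀ c : ℝ, IsClosed {x | x ∈ C ∧ g x ≤ c}) : dikin a g 1 x ⊆ C := by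
  intro z hz
  rw [dikin, mem_ofPred_eq] at hz
  set u := z - x with hu
  set r := localNorm a g x u with hr
  have hr0 : 0 ≤ r := localNorm_nonneg a g x u
  have hcont : Continuous fun s : ℝ => x + s • u := by fun_prop
  have hsegC : ∀ t : ℝ, x + t • u ∈ C → ∀ s ∈ Icc 0 t, x + s • u ∈ C := by
    intro t ht s hs
    rcases hs.1.eq_or_lt with h0 | h0
    · simpa [← h0] using hx
    have htpos : 0 < t := h0.trans_le hs.2
    have := hCc hx ht (sub_nonneg.2 ((div_le_one htpos).2 hs.2)) (div_nonneg hs.1 htpos.le)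
      (by ring)
    convert this using 1
    rw [smul_add, smul_smul, div_mul_cancel₀ s htpos.ne']
    module
  set D := inner ℝ (gradient g x) u with hD
  set K := a * (r ^ 2 / (1 - r) ^ 2) with hK
  have hK0 : 0 ≤ K := by positivity
  have hbound : ∀ t ∈ Icc (0 : ℝ) 1, x + t • u ∈ C → g (x + t • u) ≤ g x + |D| + K := by
    intro t ht htC
    have hseg := hsegC t htC
    have hat : ∀ s ∈ Icc 0 t, ContDiffAt ℝ 3 g (x + s • u) := fun s hs =>
      hg.contDiffOn.contDiffAt (hC.mem_nhds (hseg s hs))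
    have hq : ∀ s ∈ Icc 0 t, a * hessForm a g (x + s • u) u u ≤ K := by
      intro s hs
      have hs1 : r * s ≤ r := mul_le_of_le_one_right hr0 (hs.2.trans ht.2)
      have h1 := hessForm_line_le ha hC hg u u hs.1 (by linarith)
        (fun τ hτ => hseg τ ⟨hτ.1, hτ.2.trans hs.2⟩)
      rw [← hr, ← sq_localNorm ha hC hg hx, ← hr] at h1
      have h2 : hessForm a g (x + s • u) u u * (1 - r) ^ 2 ≤ r ^ 2 := by
        refine le_trans ?_ h1
        have := hessForm_self_nonneg ha hC hg (hseg s hs) u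
        have h3 : 0 ≤ 1 - r := by linarith
        gcongr
      have h3 : (0 : ℝ) < (1 - r) ^ 2 := pow_pos (by linarith) 2
      rw [hK]
      exact mul_le_mul_of_nonneg_left ((le_div_iff₀ h3).2 h2) ha.le
    have hgrad : ∀ s ∈ Icc 0 t, inner ℝ (gradient g (x + s • u)) u ≤ D + s * K := by
      intro s hs
      have := le_of_hasDerivAt_nonneg
        (f := fun τ => τ * K - a * (a⁻¹ * inner ℝ u (gradient g (x + τ • u)))) hs.1
        (fun τ hτ => ((hasDerivAt_id τ).mul_const K).sub
          ((hasDerivAt_gradient_line u u (hat τ ⟨hτ.1, hτ.2.trans hs.2⟩)).const_mul a))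
        (fun τ hτ => by
          have := hq τ ⟨hτ.1, hτ.2.trans hs.2⟩
          linarith)
      simp only [mul_inv_cancel_left₀ ha.ne', zero_smul, add_zero, zero_mul] at this
      rw [real_inner_comm, ← hD, real_inner_comm] at this
      linarith
    have := le_of_hasDerivAt_nonneg (f := fun τ => τ * (|D| + K) - g (x + τ • u)) ht.1
        (fun τ hτ => ((hasDerivAt_id τ).mul_const (|D| + K)).sub
          (hasDerivAt_comp_line u (hat τ hτ)))
        (fun τ hτ => by
          have h1 := hgrad τ hτ
          have h2 := le_abs_self D
          have h3 : τ * K ≤ K := mul_le_of_le_one_left hK0 (hτ.2.trans ht.2)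
          linarith)
    simp only [zero_smul, add_zero, zero_mul] at this
    have h4 : t * (|D| + K) ≤ |D| + K := mul_le_of_le_one_left (by positivity) ht.2
    linarith
  have hsub : Icc (0 : ℝ) 1 ⊆
      {t | x + t • u ∈ {y | y ∈ C ∧ g y ≤ g x + |D| + K}} := by
    -- the set of `t` is closed, and contains a right neighbourhood of each of its points as `C` is
    -- open and the bound for `g` holds as long as the segment stays in `C`
    refine IsClosed.Icc_subset_of_forall_mem_nhdsWithin ?_ ?_ ?_
    · exact ((hdom _).preimage hcont).inter isClosed_Icc
    · refine ⟨by simpa using hx, ?_⟩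
      simp only [zero_smul, add_zero]
      have := abs_nonneg D
      linarith
    · rintro t ⟨⟨htC, -⟩, ht0, ht1⟩
      filter_upwards [self_mem_nhdsWithin, mem_nhdsWithin_of_mem_nhds
        (hcont.continuousAt.preimage_mem_nhds (hC.mem_nhds htC)),
        mem_nhdsWithin_of_mem_nhds (Iio_mem_nhds ht1)] with s hs1 hs2 hs3
      exact ⟨hs2, hbound s ⟨ht0.trans (le_of_lt hs1), le_of_lt hs3⟩ hs2⟩
  have := (hsub ⟨zero_le_one, le_rfl⟩).1
  simpa [hu] using this

end SelfConcordant

section SelfConcordant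

variable {n : ℕ} {g : EuclideanSpace ℝ (Fin n) → ℝ} {C : Set (EuclideanSpace ℝ (Fin n))} {a : ℝ}
  {x₀ : EuclideanSpace ℝ (Fin n)}

theorem add_smul_sub_mem_of_dikin (hW : dikin a g 1 x₀ ⊆ C) {z : EuclideanSpace ℝ (Fin n)}
    (hz : localNorm a g x₀ (z - x₀) < 1) {s : ℝ} (hs : s ∈ Icc (0 : ℝ) 1) :
    x₀ + s • (z - x₀) ∈ C := by
  refine hW ?_
  rw [dikin, mem_ofPred_eq, add_sub_cancel_left, localNorm_smul, abs_of_nonneg hs.1]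
  exact (mul_le_of_le_one_left (localNorm_nonneg a g x₀ _) hs.2).trans_lt hz

theorem localNorm_mul_le_of_dikin (ha : 0 < a) (hC : IsOpen C) (hg : IsSelfConcordantOn a C g)
    (hx₀ : x₀ ∈ C) (hW : dikin a g 1 x₀ ⊆ C) {z : EuclideanSpace ℝ (Fin n)} {t : ℝ}
    (hz : localNorm a g x₀ (z - x₀) ≤ t) (ht : t < 1) (v : EuclideanSpace ℝ (Fin n)) :
    localNorm a g z v * (1 - t) ≤ localNorm a g x₀ v := by
  have hzC : z ∈ C := hW (hz.trans_lt ht)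
  have h := hessForm_line_le ha hC hg (z - x₀) v zero_le_one (by simpa using hz.trans_lt ht)
    (fun s hs => add_smul_sub_mem_of_dikin hW (hz.trans_lt ht) hs)
  rw [one_smul, add_sub_cancel, mul_one, ← sq_localNorm ha hC hg hzC,
    ← sq_localNorm ha hC hg hx₀, ← mul_pow] at h
  have h1 := localNorm_nonneg a g z v
  calc _ ≤ localNorm a g z v * (1 - localNorm a g x₀ (z - x₀)) := by gcongr
    _ ≤ _ := (abs_le_of_sq_le_sq' h (localNorm_nonneg a g x₀ v)).2

theorem mul_sq_localNorm_le_of_dikin (ha : 0 < a) (hC : IsOpen C)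
    (hg : IsSelfConcordantOn a C g) (hx₀ : x₀ ∈ C) (hW : dikin a g 1 x₀ ⊆ C)
    {z : EuclideanSpace ℝ (Fin n)} {t : ℝ} (hz : localNorm a g x₀ (z - x₀) ≤ t) (ht : t < 1)
    (v : EuclideanSpace ℝ (Fin n)) :
    (1 - t) ^ 2 * localNorm a g x₀ v ^ 2 ≤ hessForm a g z v v := by
  have h := le_hessForm_line ha hC hg (z - x₀) v zero_le_one (by simpa using hz.trans_lt ht)
    (fun s hs => add_smul_sub_mem_of_dikin hW (hz.trans_lt ht) hs)
  rw [one_smul, add_sub_cancel, mul_one, ← sq_localNorm ha hC hg hx₀] at h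
  have h0 : 0 ≤ 1 - t := by linarith
  calc _ ≤ (1 - localNorm a g x₀ (z - x₀)) ^ 2 * localNorm a g x₀ v ^ 2 := by gcongr
    _ ≤ _ := by linarith

theorem abs_thirdForm_mul_le_of_dikin (ha : 0 < a) (hC : IsOpen C)
    (hg : IsSelfConcordantOn a C g) (hx₀ : x₀ ∈ C) (hW : dikin a g 1 x₀ ⊆ C)
    {z : EuclideanSpace ℝ (Fin n)} {t : ℝ} (hz : localNorm a g x₀ (z - x₀) ≤ t) (ht : t < 1)
    (u v : EuclideanSpace ℝ (Fin n)) :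
    |thirdForm a g z u v v| ≤
      2 * localNorm a g x₀ u * localNorm a g x₀ v ^ 2 / (1 - t) ^ 3 := by
  have h0 : 0 < 1 - t := by linarith
  rw [le_div_iff₀ (by positivity)]
  have hu := localNorm_mul_le_of_dikin ha hC hg hx₀ hW hz ht u
  have hv := localNorm_mul_le_of_dikin ha hC hg hx₀ hW hz ht v
  have hu0 := localNorm_nonneg a g z u
  have hv0 := localNorm_nonneg a g z v
  calc _ ≤ 2 * localNorm a g z u * localNorm a g z v ^ 2 * (1 - t) ^ 3 := by
        gcongr
        exact abs_thirdForm_le ha hC hg (hW (hz.trans_lt ht)) u v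
    _ = 2 * (localNorm a g z u * (1 - t)) * (localNorm a g z v * (1 - t)) ^ 2 := by ring
    _ ≤ _ := by
      have hu1 := localNorm_nonneg a g x₀ u
      gcongr

/-! ### The error of the linearized gradient -/

theorem localNorm_segment_le (ha : 0 < a) (hC : IsOpen C)
    (hg : IsSelfConcordantOn a C g) (hx₀ : x₀ ∈ C) {x d : EuclideanSpace ℝ (Fin n)} {t δ : ℝ}
    (hx : localNorm a g x₀ (x - x₀) ≤ t) (hd : localNorm a g x₀ d ≤ δ) {s : ℝ} (hs : 0 ≤ s) :
    localNorm a g x₀ (x + s • d - x₀) ≤ t + s * δ := by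
  rw [add_sub_right_comm]
  refine (localNorm_add_le ha hC hg hx₀ _ _).trans ?_
  rw [localNorm_smul, abs_of_nonneg hs]
  gcongr

/-- The linearization error of the gradient, tested with a vector `h`, is at most
`(f (t + δ) - f t - f' t δ) ‖h‖`, where `f` is the scalar majorant `scMajorant b`. -/
theorem linearization_error_le (ha : 0 < a) (hC : IsOpen C)
    (hg : IsSelfConcordantOn a C g) (hx₀ : x₀ ∈ C) (hW : dikin a g 1 x₀ ⊆ C)
    {x d : EuclideanSpace ℝ (Fin n)} {t δ : ℝ} (hx : localNorm a g x₀ (x - x₀) ≤ t)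
    (hd : localNorm a g x₀ d ≤ δ) (htδ : t + δ < 1) (h : EuclideanSpace ℝ (Fin n)) :
    a⁻¹ * inner ℝ h (gradient g (x + d) - gradient g x - hess g x d) ≤
      δ ^ 2 / ((1 - t - δ) * (1 - t) ^ 2) * localNorm a g x₀ h := by
  have hd0 : 0 ≤ δ := (localNorm_nonneg a g x₀ d).trans hd
  have hz : ∀ s ∈ Icc (0 : ℝ) 1, localNorm a g x₀ (x + s • d - x₀) ≤ t + s * δ := fun s hs =>
    localNorm_segment_le ha hC hg hx₀ hx hd hs.1
  have hlt : ∀ s ∈ Icc (0 : ℝ) 1, 0 < 1 - (t + s * δ) := fun s hs => by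
    have := mul_le_of_le_one_left hd0 hs.2
    linarith
  have hzC : ∀ s ∈ Icc (0 : ℝ) 1, x + s • d ∈ C := fun s hs =>
    hW ((hz s hs).trans_lt (by linarith [hlt s hs]))
  have hat : ∀ s ∈ Icc (0 : ℝ) 1, ContDiffAt ℝ 3 g (x + s • d) := fun s hs =>
    hg.contDiffOn.contDiffAt (hC.mem_nhds (hzC s hs))
  have hk0 : ∀ s : ℝ, HasDerivAt (fun s : ℝ => 1 - (t + s * δ)) (-δ) s := fun s => by
    simpa using (((hasDerivAt_id s).mul_const δ).const_add t).const_sub 1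
  have key := taylor_remainder_le
    (f := fun s => a⁻¹ * inner ℝ h (gradient g (x + s • d)))
    (k := fun s => localNorm a g x₀ h * (1 - (t + s * δ))⁻¹)
    (k₁ := fun s => localNorm a g x₀ h * δ * ((1 - (t + s * δ)) ^ 2)⁻¹)
    (k₂ := fun s => 2 * localNorm a g x₀ h * δ ^ 2 / (1 - (t + s * δ)) ^ 3)
    (fun s hs => hasDerivAt_gradient_line d h (hat s hs))
    (fun s hs => hasDerivAt_hessForm_line hC hg.contDiffOn d h d (hzC s hs))
    (fun s hs => by
      have h1 := (hlt s hs).ne'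
      refine (((hk0 s).inv h1).const_mul (localNorm a g x₀ h)).congr_deriv ?_
      field_simp)
    (fun s hs => by
      have h1 := (hlt s hs).ne'
      refine ((((hk0 s).pow 2).inv (pow_ne_zero 2 h1)).const_mul
        (localNorm a g x₀ h * δ)).congr_deriv ?_
      simp only [Pi.pow_apply]
      generalize 1 - (t + s * δ) = w at h1 ⊢
      field_simp
      norm_num
      ring)
    (fun s hs => by
      rw [thirdForm_swap_right hC hg.contDiffOn (hzC s hs),
        thirdForm_swap_left (hat s hs)]
      refine (le_abs_self _).trans ((abs_thirdForm_mul_le_of_dikin ha hC hg hx₀ hW (hz s hs)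
        (by linarith [hlt s hs]) h d).trans ?_)
      have h1 := localNorm_nonneg a g x₀ h
      have h2 := localNorm_nonneg a g x₀ d
      have h3 := hlt s hs
      gcongr)
  have h1 : 0 < 1 - t := by linarith
  have h2 : 0 < 1 - t - δ := by linarith
  simp only [one_smul, zero_smul, add_zero, one_mul, zero_mul] at key
  rw [inner_sub_right, inner_sub_right, mul_sub, mul_sub]
  refine key.trans (le_of_eq ?_)
  rw [show 1 - (t + δ) = 1 - t - δ by ring]
  field_simp
  ring

/-- The linearization error of the gradient, tested with a vector `h`, in terms of the
Lipschitz constant `2 / (1 - ρ) ^ 3` of the second derivative on the ellipsoid of radius `ρ`. -/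
theorem linearization_error_le_sq (ha : 0 < a) (hC : IsOpen C)
    (hg : IsSelfConcordantOn a C g) (hx₀ : x₀ ∈ C) (hW : dikin a g 1 x₀ ⊆ C)
    {x y : EuclideanSpace ℝ (Fin n)} {ρ : ℝ} (hx : localNorm a g x₀ (x - x₀) ≤ ρ)
    (hy : localNorm a g x₀ (y - x₀) ≤ ρ) (hρ : ρ < 1) (h : EuclideanSpace ℝ (Fin n)) :
    a⁻¹ * inner ℝ h (gradient g y - gradient g x - hess g x (y - x)) ≤
      localNorm a g x₀ (y - x) ^ 2 / (1 - ρ) ^ 3 * localNorm a g x₀ h := by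
  have hz : ∀ s ∈ Icc (0 : ℝ) 1, localNorm a g x₀ (x + s • (y - x) - x₀) ≤ ρ := fun s hs =>
    (convex_localNorm_le ha hC hg hx₀ ρ).add_smul_sub_mem hx hy hs
  have hzC : ∀ s ∈ Icc (0 : ℝ) 1, x + s • (y - x) ∈ C := fun s hs => hW ((hz s hs).trans_lt hρ)
  have hat : ∀ s ∈ Icc (0 : ℝ) 1, ContDiffAt ℝ 3 g (x + s • (y - x)) := fun s hs =>
    hg.contDiffOn.contDiffAt (hC.mem_nhds (hzC s hs))
  have key := taylor_remainder_le
    (f := fun s => a⁻¹ * inner ℝ h (gradient g (x + s • (y - x))))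
    (k := fun s => localNorm a g x₀ h * localNorm a g x₀ (y - x) ^ 2 / (1 - ρ) ^ 3 * s ^ 2)
    (k₁ := fun s => localNorm a g x₀ h * localNorm a g x₀ (y - x) ^ 2 / (1 - ρ) ^ 3 * (2 * s))
    (k₂ := fun s => localNorm a g x₀ h * localNorm a g x₀ (y - x) ^ 2 / (1 - ρ) ^ 3 * 2)
    (fun s hs => hasDerivAt_gradient_line (y - x) h (hat s hs))
    (fun s hs => hasDerivAt_hessForm_line hC hg.contDiffOn (y - x) h (y - x) (hzC s hs))
    (fun s hs => ((hasDerivAt_pow 2 s).const_mul _).congr_deriv (by norm_num))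
    (fun s hs => (((hasDerivAt_id s).const_mul 2).const_mul _).congr_deriv (by ring))
    (fun s hs => by
      rw [thirdForm_swap_right hC hg.contDiffOn (hzC s hs),
        thirdForm_swap_left (hat s hs)]
      refine (le_abs_self _).trans ((abs_thirdForm_mul_le_of_dikin ha hC hg hx₀ hW (hz s hs)
        hρ h (y - x)).trans (le_of_eq ?_))
      ring)
  simp only [one_smul, zero_smul, add_zero, add_sub_cancel] at key
  rw [inner_sub_right, inner_sub_right, mul_sub, mul_sub]
  refine key.trans (le_of_eq ?_)
  ring

/-- The gradient is strongly monotone on every Dikin ellipsoid of radius less than `1`. -/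
theorem mul_sq_localNorm_le_inner_gradient (ha : 0 < a) (hC : IsOpen C)
    (hg : IsSelfConcordantOn a C g) (hx₀ : x₀ ∈ C) (hW : dikin a g 1 x₀ ⊆ C)
    {x y : EuclideanSpace ℝ (Fin n)} {ρ : ℝ} (hx : localNorm a g x₀ (x - x₀) ≤ ρ)
    (hy : localNorm a g x₀ (y - x₀) ≤ ρ) (hρ : ρ < 1) :
    (1 - ρ) ^ 2 * localNorm a g x₀ (y - x) ^ 2 ≤
      a⁻¹ * inner ℝ (y - x) (gradient g y - gradient g x) := by
  have hz : ∀ s ∈ Icc (0 : ℝ) 1, localNorm a g x₀ (x + s • (y - x) - x₀) ≤ ρ := fun s hs =>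
    (convex_localNorm_le ha hC hg hx₀ ρ).add_smul_sub_mem hx hy hs
  have hat : ∀ s ∈ Icc (0 : ℝ) 1, ContDiffAt ℝ 3 g (x + s • (y - x)) := fun s hs =>
    hg.contDiffOn.contDiffAt (hC.mem_nhds (hW ((hz s hs).trans_lt hρ)))
  have key := le_of_hasDerivAt_nonneg
    (f := fun s => a⁻¹ * inner ℝ (y - x) (gradient g (x + s • (y - x))) -
      s * ((1 - ρ) ^ 2 * localNorm a g x₀ (y - x) ^ 2)) (zero_le_one' ℝ)
    (fun s hs => (hasDerivAt_gradient_line (y - x) (y - x) (hat s hs)).sub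
      ((hasDerivAt_id s).mul_const _))
    (fun s hs => by
      have := mul_sq_localNorm_le_of_dikin ha hC hg hx₀ hW (hz s hs) hρ (y - x)
      linarith)
  simp only [one_smul, zero_smul, add_zero, add_sub_cancel] at key
  rw [inner_sub_right, mul_sub]
  linarith

/-! ### The residual norm -/

theorem hess_inverse_apply (hinv : (hess g x₀).IsInvertible) (v : EuclideanSpace ℝ (Fin n)) :
    hess g x₀ ((hess g x₀).inverse v) = v := by
  obtain ⟨e, he⟩ := hinv
  rw [← he]
  simp

theorem hessForm_inverse (hinv : (hess g x₀).IsInvertible) (h v : EuclideanSpace ℝ (Fin n)) :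
    hessForm a g x₀ h ((hess g x₀).inverse v) = a⁻¹ * inner ℝ h v := by
  rw [hessForm, hess_inverse_apply hinv]

theorem inner_le_residualNorm_mul (ha : 0 < a) (hC : IsOpen C)
    (hg : IsSelfConcordantOn a C g) (hx₀ : x₀ ∈ C) (hinv : (hess g x₀).IsInvertible)
    (h v : EuclideanSpace ℝ (Fin n)) :
    a⁻¹ * inner ℝ h v ≤ residualNorm a g x₀ v * localNorm a g x₀ h := by
  rw [← hessForm_inverse hinv, mul_comm]
  exact (le_abs_self _).trans (abs_hessForm_le ha hC hg hx₀ _ _)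

/-- The residual norm is the dual of the local norm at `x₀`. -/
theorem residualNorm_le (ha : 0 < a) (hC : IsOpen C)
    (hg : IsSelfConcordantOn a C g) (hx₀ : x₀ ∈ C) (hinv : (hess g x₀).IsInvertible)
    {v : EuclideanSpace ℝ (Fin n)} {M : ℝ} (hM : 0 ≤ M)
    (h : ∀ w, a⁻¹ * inner ℝ w v ≤ M * localNorm a g x₀ w) : residualNorm a g x₀ v ≤ M := by
  have h1 := h ((hess g x₀).inverse v)
  rw [← hessForm_inverse hinv, ← sq_localNorm ha hC hg hx₀] at h1
  change residualNorm a g x₀ v ^ 2 ≤ M * residualNorm a g x₀ v at h1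
  have h2 : 0 ≤ residualNorm a g x₀ v := localNorm_nonneg _ _ _ _
  nlinarith

theorem residualNorm_nonneg (a : ℝ) (g : EuclideanSpace ℝ (Fin n) → ℝ)
    (x₀ v : EuclideanSpace ℝ (Fin n)) : 0 ≤ residualNorm a g x₀ v :=
  localNorm_nonneg _ _ _ _

theorem residualNorm_add_le (ha : 0 < a) (hC : IsOpen C)
    (hg : IsSelfConcordantOn a C g) (hx₀ : x₀ ∈ C) (u v : EuclideanSpace ℝ (Fin n)) :
    residualNorm a g x₀ (u + v) ≤ residualNorm a g x₀ u + residualNorm a g x₀ v := by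
  simp only [residualNorm, map_add]
  exact localNorm_add_le ha hC hg hx₀ _ _

theorem residualNorm_neg (a : ℝ) (g : EuclideanSpace ℝ (Fin n) → ℝ)
    (x₀ v : EuclideanSpace ℝ (Fin n)) : residualNorm a g x₀ (-v) = residualNorm a g x₀ v := by
  simp only [residualNorm, map_neg, localNorm_neg]

theorem residualNorm_zero (a : ℝ) (g : EuclideanSpace ℝ (Fin n) → ℝ)
    (x₀ : EuclideanSpace ℝ (Fin n)) : residualNorm a g x₀ 0 = 0 := by
  simp only [residualNorm, map_zero, localNorm_zero]

theorem exists_norm_le_mul_localNorm (ha : 0 < a) (hC : IsOpen C)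
    (hg : IsSelfConcordantOn a C g) (hx₀ : x₀ ∈ C) (hinv : (hess g x₀).IsInvertible) :
    ∃ K : ℝ, 0 ≤ K ∧ ∀ v, ‖v‖ ≤ K * localNorm a g x₀ v := by
  set A := √(a⁻¹ * ‖hess g x₀‖) * ‖(hess g x₀).inverse‖ with hA
  have hR : ∀ v, residualNorm a g x₀ v ≤ A * ‖v‖ := by
    have h1 : ∀ w, localNorm a g x₀ w ≤ √(a⁻¹ * ‖hess g x₀‖) * ‖w‖ := by
      intro w
      rw [localNorm, ← Real.sqrt_sq (norm_nonneg w), ← Real.sqrt_mul (by positivity)]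
      apply Real.sqrt_le_sqrt
      rw [mul_assoc]
      gcongr
      calc _ ≤ ‖w‖ * ‖hess g x₀ w‖ := real_inner_le_norm _ _
        _ ≤ ‖w‖ * (‖hess g x₀‖ * ‖w‖) := by gcongr; exact (hess g x₀).le_opNorm w
        _ = _ := by ring
    intro v
    calc _ ≤ √(a⁻¹ * ‖hess g x₀‖) * ‖(hess g x₀).inverse v‖ := h1 _
      _ ≤ √(a⁻¹ * ‖hess g x₀‖) * (‖(hess g x₀).inverse‖ * ‖v‖) := by
        gcongr; exact ContinuousLinearMap.le_opNorm _ v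
      _ = _ := by rw [hA]; ring
  refine ⟨a * A, by positivity, fun v => ?_⟩
  have hN := localNorm_nonneg a g x₀ v
  rcases (norm_nonneg v).eq_or_lt with h0 | h0
  · rw [← h0]; positivity
  have h2 := inner_le_residualNorm_mul ha hC hg hx₀ hinv v v
  rw [real_inner_self_eq_norm_sq, inv_mul_le_iff₀ ha] at h2
  have h3 : a * (residualNorm a g x₀ v * localNorm a g x₀ v) ≤
      a * (A * ‖v‖ * localNorm a g x₀ v) := by
    gcongr; exact hR v
  nlinarith

theorem eq_zero_of_localNorm_eq_zero (ha : 0 < a) (hC : IsOpen C)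
    (hg : IsSelfConcordantOn a C g) (hx₀ : x₀ ∈ C) (hinv : (hess g x₀).IsInvertible)
    {v : EuclideanSpace ℝ (Fin n)} (h : localNorm a g x₀ v = 0) : v = 0 := by
  obtain ⟨K, -, hK⟩ := exists_norm_le_mul_localNorm ha hC hg hx₀ hinv
  have := hK v
  rw [h, mul_zero] at this
  exact norm_le_zero_iff.1 this

theorem mul_localNorm_sub_le_residualNorm (ha : 0 < a) (hC : IsOpen C)
    (hg : IsSelfConcordantOn a C g) (hx₀ : x₀ ∈ C) (hinv : (hess g x₀).IsInvertible)
    (hW : dikin a g 1 x₀ ⊆ C) {x y : EuclideanSpace ℝ (Fin n)} {ρ : ℝ}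
    (hx : localNorm a g x₀ (x - x₀) ≤ ρ) (hy : localNorm a g x₀ (y - x₀) ≤ ρ) (hρ : ρ < 1) :
    (1 - ρ) ^ 2 * localNorm a g x₀ (y - x) ≤
      residualNorm a g x₀ (gradient g y - gradient g x) := by
  have h1 := mul_sq_localNorm_le_inner_gradient ha hC hg hx₀ hW hx hy hρ
  have h2 := inner_le_residualNorm_mul ha hC hg hx₀ hinv (y - x) (gradient g y - gradient g x)
  have hN := localNorm_nonneg a g x₀ (y - x)
  rcases hN.eq_or_lt with h0 | h0
  · rw [← h0, mul_zero]
    exact residualNorm_nonneg _ _ _ _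
  · nlinarith

theorem mul_localNorm_le_residualNorm_hess (ha : 0 < a) (hC : IsOpen C)
    (hg : IsSelfConcordantOn a C g) (hx₀ : x₀ ∈ C) (hinv : (hess g x₀).IsInvertible)
    (hW : dikin a g 1 x₀ ⊆ C) {x : EuclideanSpace ℝ (Fin n)} {t : ℝ}
    (hx : localNorm a g x₀ (x - x₀) ≤ t) (ht : t < 1) (v : EuclideanSpace ℝ (Fin n)) :
    (1 - t) ^ 2 * localNorm a g x₀ v ≤ residualNorm a g x₀ (hess g x v) := by
  have h1 := mul_sq_localNorm_le_of_dikin ha hC hg hx₀ hW hx ht v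
  have h2 := inner_le_residualNorm_mul ha hC hg hx₀ hinv v (hess g x v)
  have hN := localNorm_nonneg a g x₀ v
  rcases hN.eq_or_lt with h0 | h0
  · rw [← h0, mul_zero]
    exact residualNorm_nonneg _ _ _ _
  · rw [hessForm] at h1
    nlinarith

theorem residualNorm_hess_le (ha : 0 < a) (hC : IsOpen C)
    (hg : IsSelfConcordantOn a C g) (hx₀ : x₀ ∈ C) (hinv : (hess g x₀).IsInvertible)
    (hW : dikin a g 1 x₀ ⊆ C) {x : EuclideanSpace ℝ (Fin n)} {t : ℝ}
    (hx : localNorm a g x₀ (x - x₀) ≤ t) (ht : t < 1) (v : EuclideanSpace ℝ (Fin n)) :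
    residualNorm a g x₀ (hess g x v) ≤ localNorm a g x₀ v / (1 - t) ^ 2 := by
  have h0 : 0 < 1 - t := by linarith
  have hv := localNorm_mul_le_of_dikin ha hC hg hx₀ hW hx ht v
  have hN := localNorm_nonneg a g x₀ v
  refine residualNorm_le ha hC hg hx₀ hinv (by positivity) fun w => ?_
  have hw := localNorm_mul_le_of_dikin ha hC hg hx₀ hW hx ht w
  have h1 := (le_abs_self _).trans (abs_hessForm_le ha hC hg (hW (hx.trans_lt ht)) w v)
  rw [hessForm] at h1
  rw [div_mul_eq_mul_div, le_div_iff₀ (by positivity)]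
  have hw0 := localNorm_nonneg a g x w
  have hv0 := localNorm_nonneg a g x v
  calc _ ≤ localNorm a g x w * localNorm a g x v * (1 - t) ^ 2 := by gcongr
    _ = (localNorm a g x v * (1 - t)) * (localNorm a g x w * (1 - t)) := by ring
    _ ≤ _ := by gcongr

theorem isInvertible_hess_of_dikin (ha : 0 < a) (hC : IsOpen C)
    (hg : IsSelfConcordantOn a C g) (hx₀ : x₀ ∈ C) (hinv : (hess g x₀).IsInvertible)
    (hW : dikin a g 1 x₀ ⊆ C) {x : EuclideanSpace ℝ (Fin n)}
    (hx : localNorm a g x₀ (x - x₀) < 1) : (hess g x).IsInvertible := by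
  have hinj : Function.Injective (hess g x) := by
    rw [injective_iff_map_eq_zero]
    intro v hv
    have h1 := mul_localNorm_le_residualNorm_hess ha hC hg hx₀ hinv hW le_rfl hx v
    rw [hv, residualNorm_zero] at h1
    have h2 : 0 < (1 - localNorm a g x₀ (x - x₀)) ^ 2 := pow_pos (by linarith) 2
    exact eq_zero_of_localNorm_eq_zero ha hC hg hx₀ hinv
      (le_antisymm (by nlinarith) (localNorm_nonneg a g x₀ v))
  exact ⟨(LinearEquiv.ofInjectiveEndo (hess g x : _ →ₗ[ℝ] _) hinj).toContinuousLinearEquiv, rfl⟩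

end SelfConcordant

/-! ### The scalar majorant -/

/-- The numbers attached to `b` and `θ`, with `β = √b`. As `b < 3 - 2 √2 = (√2 - 1)²`, the slope
`κ = 1 - 2 √b - b = 2 - (1 + √b)²` of the majorant at `λ = √b / (1 + √b)` is negative. The bound
for `θ` is `θ ≤ κ / (2 - κ)`. -/
structure MajorantData (b θ β κ l : ℝ) : Prop where
  β_pos : 0 < β
  sq_β : β ^ 2 = b
  sq_lt : (1 + β) ^ 2 < 2
  κ_eq : κ = 2 - (1 + β) ^ 2
  l_eq : l = 1 - (1 + β)⁻¹
  θ_nonneg : 0 ≤ θ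
  θ_mul_le : θ * (1 + β) ^ 2 ≤ 2 - (1 + β) ^ 2

theorem majorantData_of {b θ lam : ℝ} (hb : 0 < b) (hb' : b < 3 - 2 * √2) (hθ : 0 ≤ θ)
    (hθ' : θ ≤ (1 - 2 * √b - b) / (1 + 2 * √b + b)) (hlam : lam = b / (√b + b)) :
    MajorantData b θ (√b) (1 - 2 * √b - b) lam := by
  have hβ : 0 < √b := Real.sqrt_pos.2 hb
  have hsq : √b ^ 2 = b := Real.sq_sqrt hb.le
  have h2 : √(2 : ℝ) ^ 2 = 2 := Real.sq_sqrt (by norm_num)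
  have h20 : 0 < √(2 : ℝ) := by positivity
  have hlt : 1 + √b < √2 := by
    have h3 : √b ^ 2 < (√2 - 1) ^ 2 := by nlinarith
    have h4 : 1 < √(2 : ℝ) := by nlinarith
    have := abs_lt_of_sq_lt_sq' h3 (by linarith)
    linarith [this.2]
  refine ⟨hβ, hsq, by nlinarith, by linarith, ?_, hθ, ?_⟩
  · rw [hlam]
    nth_rewrite 1 3 [← hsq]
    field_simp
    ring
  · rw [le_div_iff₀ (by positivity)] at hθ'
    nlinarith

namespace MajorantData

variable {b θ β κ l : ℝ}

theorem κ_pos (h : MajorantData b θ β κ l) : 0 < κ := by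
  rw [h.κ_eq]; linarith [h.sq_lt]

theorem one_sub_l (h : MajorantData b θ β κ l) : 1 - l = (1 + β)⁻¹ := by
  rw [h.l_eq]; ring

theorem l_lt_one (h : MajorantData b θ β κ l) : l < 1 := by
  have : 0 < (1 + β)⁻¹ := inv_pos.2 (by linarith [h.β_pos])
  linarith [h.one_sub_l]

theorem l_pos (h : MajorantData b θ β κ l) : 0 < l := by
  have : (1 + β)⁻¹ < 1 := inv_lt_one_of_one_lt₀ (by linarith [h.β_pos])
  linarith [h.one_sub_l]

theorem θ_lt_one (h : MajorantData b θ β κ l) : θ < 1 := by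
  have h1 := h.β_pos
  have h2 := h.θ_mul_le
  have h3 := h.θ_nonneg
  nlinarith

/-- With `u = (1 + β)²` this is `2 - u ≤ 1 / u`. -/
theorem κ_le_sq (h : MajorantData b θ β κ l) : κ ≤ (1 - l) ^ 2 := by
  have h1 : 0 < (1 + β) ^ 2 := pow_pos (by linarith [h.β_pos]) 2
  rw [h.one_sub_l, h.κ_eq, inv_pow, le_inv_comm₀ (by linarith [h.sq_lt]) h1,
    le_inv_comm₀ h1 (by linarith [h.sq_lt]), ← one_div, le_div_iff₀ h1]
  nlinarith [sq_nonneg ((1 + β) ^ 2 - 1)]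

end MajorantData

/-- The scalar inexact Newton step for the majorant `f`, on pairs `(t, ε)`: the first component
bounds the distance from the starting point, and `f t + ε` the residual. -/
noncomputable def majorantStep (b θ : ℝ) (p : ℝ × ℝ) : ℝ × ℝ :=
  (p.1 + (1 + θ) * (scMajorant b p.1 + p.2) / (2 - ((1 - p.1) ^ 2)⁻¹),
    p.2 + 2 * θ * (scMajorant b p.1 + p.2))

/-- The pairs on which the scalar inexact Newton iteration operates. -/
structure MajorantRegion (b κ l : ℝ) (p : ℝ × ℝ) : Prop where
  nonneg : 0 ≤ p.1
  lt : p.1 < l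
  nonneg' : 0 ≤ p.2
  le_mul : p.2 ≤ κ * p.1
  residual_nonneg : 0 ≤ scMajorant b p.1 + p.2

/-- Taylor's formula for the majorant, with its remainder in closed form. -/
theorem scMajorant_add {b t δ : ℝ} (ht : t < 1) (hδ : t + δ < 1) :
    scMajorant b (t + δ) = scMajorant b t - (2 - ((1 - t) ^ 2)⁻¹) * δ +
      δ ^ 2 / ((1 - t - δ) * (1 - t) ^ 2) := by
  have h1 : 1 - t ≠ 0 := by linarith
  have h2 : 1 - t - δ ≠ 0 := by linarith
  have h3 : 1 - (t + δ) ≠ 0 := by linarith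
  rw [scMajorant, scMajorant, show 1 - (t + δ) = 1 - t - δ by ring]
  field_simp
  ring

variable {b θ β κ l : ℝ} {p : ℝ × ℝ}

/-- In terms of `w = 1 / (1 - t)` the slope of the majorant at `t` is `-(2 - w²)`, which is
negative to the left of `l`, that is, for `w < 1 + β`. -/
theorem MajorantRegion.slope_pos (h : MajorantData b θ β κ l) (hp : MajorantRegion b κ l p) :
    0 < 2 - ((1 - p.1) ^ 2)⁻¹ ∧ 1 ≤ (1 - p.1)⁻¹ ∧ (1 - p.1)⁻¹ < 1 + β := by
  have h1 := h.one_sub_l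
  have h0 := h.β_pos
  have hl := h.l_lt_one
  have hlt := hp.lt
  have h2 : 0 < 1 - p.1 := by linarith
  have h3 : (1 - p.1)⁻¹ < 1 + β := by
    rw [inv_lt_comm₀ h2 (by linarith), ← h1]
    linarith
  have h4 : 1 ≤ (1 - p.1)⁻¹ := (one_le_inv₀ h2).2 (by linarith [hp.nonneg])
  refine ⟨?_, h4, h3⟩
  have := h.sq_lt
  rw [← inv_pow]
  nlinarith

/-- In terms of `w = 1 / (1 - t)` one has `f t + κ t = (1 + β - w)² / w`: the line of slope `-κ`
through the origin touches the graph of `f` at `l`. -/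
theorem MajorantRegion.residual_le (h : MajorantData b θ β κ l) (hp : MajorantRegion b κ l p) :
    (scMajorant b p.1 + p.2) * (1 - p.1)⁻¹ ≤ (1 + β - (1 - p.1)⁻¹) ^ 2 := by
  have h2 : 0 < 1 - p.1 := by linarith [h.l_lt_one, hp.lt]
  have h3 : scMajorant b p.1 + p.2 ≤ scMajorant b p.1 + κ * p.1 := by linarith [hp.le_mul]
  refine (mul_le_mul_of_nonneg_right h3 (inv_pos.2 h2).le).trans (le_of_eq ?_)
  rw [scMajorant, h.κ_eq, ← h.sq_β]
  field_simp
  ring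

/-- Invariance of the region and the rate `(1 + θ²) / 2` for the residual, of which only
nonnegativity after the step is left open; it is supplied by the vector iteration. -/
theorem MajorantRegion.step (h : MajorantData b θ β κ l) (hp : MajorantRegion b κ l p) :
    (p.1 ≤ (majorantStep b θ p).1 ∧ (majorantStep b θ p).1 < l) ∧
    (0 ≤ (majorantStep b θ p).2 ∧ (majorantStep b θ p).2 ≤ κ * (majorantStep b θ p).1) ∧
    scMajorant b (majorantStep b θ p).1 + (majorantStep b θ p).2 ≤
      (1 + θ ^ 2) / 2 * (scMajorant b p.1 + p.2) := by
  obtain ⟨hD, hw1, hw2⟩ := hp.slope_pos h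
  have hres := hp.residual_le h
  have hm := hp.residual_nonneg
  have hl1 := h.l_lt_one
  have hlt := hp.lt
  have h1l := h.one_sub_l
  obtain ⟨t, ε⟩ := p
  have hε := hp.nonneg'
  have hεt := hp.le_mul
  simp only [majorantStep] at *
  set m := scMajorant b t + ε with hmdef
  have ht1 : 0 < 1 - t := by linarith
  rw [← inv_pow] at hD ⊢
  set w := (1 - t)⁻¹ with hw
  have htw : 1 - t = w⁻¹ := by rw [hw, inv_inv]
  have hβ := h.β_pos
  have hθ := h.θ_nonneg
  have hθW := h.θ_mul_le
  have hW2 := h.sq_lt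
  obtain ⟨W, hW⟩ : ∃ W, W = 1 + β := ⟨_, rfl⟩
  rw [← hW] at hw2 hres hθW hW2 h1l
  have hκ : κ = 2 - W ^ 2 := by rw [h.κ_eq, hW]
  have hθ1 := h.θ_lt_one
  have hw0 : 0 < w := by linarith
  have hW0 : 0 < W := by linarith
  set D := 2 - w ^ 2 with hDdef
  set δ := (1 + θ) * m / D with hδ
  have hw1sq : 1 ≤ w ^ 2 := one_le_pow₀ hw1
  have hδ0 : 0 ≤ δ := by positivity
  have hδD : D * δ = (1 + θ) * m := by rw [hδ]; field_simp
  -- the step stays to the left of `l`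
  have hstep : δ * (w * W) < W - w := by
    have e1 : (1 + θ) * ((W - w) * W) < D := by
      have e2 : (1 + θ) * W ^ 2 ≤ 2 := by linarith
      have e3 : W * ((1 + θ) * ((W - w) * W)) ≤ 2 * (W - w) := by
        have := mul_le_mul_of_nonneg_right e2 (sub_nonneg.2 hw2.le)
        linarith
      have e4 : w * W < 2 := by
        have := mul_le_mul_of_nonneg_right hw2.le hW0.le
        linarith
      have e5 : 2 * (W - w) < W * D := by
        have : 0 < w * (2 - w * W) := by apply mul_pos hw0; linarith
        rw [hDdef]; linarith
      exact lt_of_mul_lt_mul_left (e3.trans_lt e5) hW0.le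
    have e6 : D * (δ * (w * W)) ≤ (W - w) * ((1 + θ) * ((W - w) * W)) := by
      calc D * (δ * (w * W)) = (m * w) * ((1 + θ) * W) := by
            rw [← mul_assoc, hδD]; ring
        _ ≤ (W - w) ^ 2 * ((1 + θ) * W) := by gcongr
        _ = _ := by ring
    have e7 : (W - w) * ((1 + θ) * ((W - w) * W)) < (W - w) * D := by
      apply mul_lt_mul_of_pos_left e1; linarith
    exact lt_of_mul_lt_mul_left (by linarith) hD.le
  have hlt' : t + δ < l := by
    have e1 : l - t = w⁻¹ - W⁻¹ := by rw [← htw, ← h1l]; ring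
    have e2 : w⁻¹ - W⁻¹ = (W - w) / (w * W) := by field_simp
    have e3 : δ < (W - w) / (w * W) := (lt_div_iff₀ (by positivity)).2 hstep
    linarith
  refine ⟨⟨by linarith, hlt'⟩, ⟨by positivity, ?_⟩, ?_⟩
  · have e1 : 2 * θ * m ≤ κ * δ := by
      have e2 : 2 * θ * D ≤ κ * (1 + θ) := by
        rw [hκ]
        have : θ * D ≤ θ * 1 := by
          apply mul_le_mul_of_nonneg_left _ hθ
          rw [hDdef]; linarith
        linarith
      have e3 : D * (2 * θ * m) ≤ D * (κ * δ) := by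
        calc D * (2 * θ * m) = 2 * θ * D * m := by ring
          _ ≤ κ * (1 + θ) * m := by gcongr
          _ = κ * (D * δ) := by rw [hδD]; ring
          _ = _ := by ring
      exact le_of_mul_le_mul_left e3 hD
    linarith
  · rw [scMajorant_add (by linarith) (by linarith), ← inv_pow, ← hw, ← hDdef, hδD]
    -- the Taylor remainder, as `1 - t - δ ≥ 1 - l = 1 / W`
    have e1 : δ ^ 2 / ((1 - t - δ) * (1 - t) ^ 2) ≤ δ ^ 2 * w ^ 2 * W := by
      have e2 : W⁻¹ ≤ 1 - t - δ := by linarith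
      calc δ ^ 2 / ((1 - t - δ) * (1 - t) ^ 2) ≤ δ ^ 2 / (W⁻¹ * (1 - t) ^ 2) := by
            gcongr
        _ = _ := by rw [htw]; field_simp
    have e3 : (1 + θ) * (W ^ 2 - w ^ 2) ≤ (1 - θ) * D := by
      rw [hDdef]
      have := mul_nonpos_of_nonneg_of_nonpos hθ (show 2 - 2 * w ^ 2 ≤ 0 by linarith)
      linarith
    have e4 : D ^ 2 * (δ ^ 2 * w ^ 2 * W) ≤ D ^ 2 * ((1 - θ) ^ 2 / 2 * m) := by
      have hWw : 0 < W - w := by linarith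
      have hsq : 0 ≤ W ^ 2 - w ^ 2 := by
        have := mul_pos hWw (add_pos hW0 hw0)
        linarith
      calc D ^ 2 * (δ ^ 2 * w ^ 2 * W) = (D * δ) ^ 2 * w ^ 2 * W := by ring
        _ = (1 + θ) ^ 2 * m * (m * w) * (w * W) := by rw [hδD]; ring
        _ ≤ (1 + θ) ^ 2 * m * (W - w) ^ 2 * (w * W) := by gcongr
        _ ≤ (1 + θ) ^ 2 * m * (W - w) ^ 2 * ((W + w) ^ 2 / 2) := by
          gcongr
          linarith [sq_nonneg W, sq_nonneg w]
        _ = ((1 + θ) * (W ^ 2 - w ^ 2)) ^ 2 * (m / 2) := by ring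
        _ ≤ ((1 - θ) * D) ^ 2 * (m / 2) := by gcongr
        _ = _ := by ring
    have e5 := le_of_mul_le_mul_left e4 (by positivity)
    have e6 : m = scMajorant b t + ε := hmdef
    linarith

theorem majorantRegion_zero (h : MajorantData b θ β κ l) (hb : 0 < b) :
    MajorantRegion b κ l (0, 0) :=
  ⟨le_rfl, h.l_pos, le_rfl, by simp, by simpa [scMajorant] using hb.le⟩

theorem hasDerivAt_scMajorant (b : ℝ) {t : ℝ} (ht : t < 1) :
    HasDerivAt (scMajorant b) (((1 - t) ^ 2)⁻¹ - 2) t := by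
  have h1 : 1 - t ≠ 0 := by linarith
  refine ((((hasDerivAt_id t).div ((hasDerivAt_id t).const_sub 1) h1).sub
    ((hasDerivAt_id t).const_mul 2)).add_const b).congr_deriv ?_
  simp only [id]
  field_simp
  ring

theorem derivWithin_deriv_scMajorant (b : ℝ) {t : ℝ} (ht : t < 1) :
    derivWithin (deriv (scMajorant b)) (Iio t) t = 2 / (1 - t) ^ 3 := by
  have h1 : 1 - t ≠ 0 := by linarith
  have h2 : HasDerivAt (deriv (scMajorant b)) (2 / (1 - t) ^ 3) t := by
    have h3 : HasDerivAt (fun s : ℝ => ((1 - s) ^ 2)⁻¹ - 2) (2 / (1 - t) ^ 3) t := by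
      refine (((((hasDerivAt_id t).const_sub 1).pow 2).inv (pow_ne_zero 2 h1)).sub_const 2
        ).congr_deriv ?_
      simp only [Pi.pow_apply, id]
      field_simp
      norm_num
      field_simp
    refine h3.congr_of_eventuallyEq ?_
    filter_upwards [Iio_mem_nhds ht] with s hs
    exact (hasDerivAt_scMajorant b hs).deriv
  exact h2.hasDerivWithinAt.derivWithin (uniqueDiffWithinAt_Iio t)

section SelfConcordant

variable {n : ℕ} {g : EuclideanSpace ℝ (Fin n) → ℝ} {C : Set (EuclideanSpace ℝ (Fin n))} {a : ℝ}
  {x₀ : EuclideanSpace ℝ (Fin n)}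

/-! ### The minimizer -/

/-- The integral of the lower bound `(1 - s r)² r²` for the second derivative along `u`. -/
theorem le_inner_gradient_add (ha : 0 < a) (hC : IsOpen C) (hg : IsSelfConcordantOn a C g)
    (hx₀ : x₀ ∈ C) (hinv : (hess g x₀).IsInvertible) (hW : dikin a g 1 x₀ ⊆ C)
    {u : EuclideanSpace ℝ (Fin n)} {b r : ℝ} (hu : localNorm a g x₀ u = r) (hr : r < 1)
    (hb : residualNorm a g x₀ (gradient g x₀) ≤ b) :
    r * (r - r ^ 2 + r ^ 3 / 3 - b) ≤ a⁻¹ * inner ℝ u (gradient g (x₀ + u)) := by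
  have hr0 : 0 ≤ r := hu ▸ localNorm_nonneg a g x₀ u
  have hz : ∀ s ∈ Icc (0 : ℝ) 1, localNorm a g x₀ (x₀ + s • u - x₀) ≤ s * r := fun s hs => by
    rw [add_sub_cancel_left, localNorm_smul, abs_of_nonneg hs.1, hu]
  have hlt : ∀ s ∈ Icc (0 : ℝ) 1, s * r < 1 := fun s hs =>
    (mul_le_of_le_one_left hr0 hs.2).trans_lt hr
  have key := le_of_hasDerivAt_nonneg
    (f := fun s => a⁻¹ * inner ℝ u (gradient g (x₀ + s • u)) -
      (s * r ^ 2 - s ^ 2 * r ^ 3 + s ^ 3 * (r ^ 4 / 3))) (zero_le_one' ℝ)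
    (fun s hs => (hasDerivAt_gradient_line u u (hg.contDiffOn.contDiffAt
        (hC.mem_nhds (hW ((hz s hs).trans_lt (hlt s hs)))))).sub
      ((((hasDerivAt_id s).mul_const (r ^ 2)).sub ((hasDerivAt_pow 2 s).mul_const (r ^ 3))).add
        ((hasDerivAt_pow 3 s).mul_const (r ^ 4 / 3))))
    (fun s hs => by
      have := mul_sq_localNorm_le_of_dikin ha hC hg hx₀ hW (hz s hs) (hlt s hs) u
      rw [hu] at this
      norm_num
      linarith)
  have h0 := inner_le_residualNorm_mul ha hC hg hx₀ hinv (-u) (gradient g x₀)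
  rw [localNorm_neg, hu, inner_neg_left] at h0
  have h1 := mul_le_mul_of_nonneg_right hb hr0
  simp only [one_smul, zero_smul, add_zero] at key
  linarith

/-- On the boundary of the ellipsoid of radius `r` the gradient points outwards, hence `g` has a
minimizer in its interior. -/
theorem exists_isMinOn (ha : 0 < a) (hC : IsOpen C) (hg : IsSelfConcordantOn a C g)
    (hx₀ : x₀ ∈ C) (hinv : (hess g x₀).IsInvertible) (hW : dikin a g 1 x₀ ⊆ C)
    {b r : ℝ} (hr0 : 0 < r) (hr : r < 1) (hbr : b < r - r ^ 2 + r ^ 3 / 3)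
    (hb : residualNorm a g x₀ (gradient g x₀) ≤ b) :
    ∃ xs ∈ C, IsMinOn g C xs ∧ localNorm a g x₀ (xs - x₀) < r := by
  set K : Set (EuclideanSpace ℝ (Fin n)) := {z | localNorm a g x₀ (z - x₀) ≤ r} with hK
  have hKC : K ⊆ C := fun z hz => hW (lt_of_le_of_lt hz hr)
  have hcont : Continuous fun z => localNorm a g x₀ (z - x₀) :=
    (continuous_localNorm a g x₀).comp (by fun_prop)
  obtain ⟨A, hA, hAle⟩ := exists_norm_le_mul_localNorm ha hC hg hx₀ hinv
  have hcomp : IsCompact K := by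
    refine (isCompact_closedBall x₀ (A * r)).of_isClosed_subset
      (isClosed_le hcont continuous_const) fun z hz => ?_
    rw [mem_closedBall_iff_norm]
    exact (hAle _).trans (mul_le_mul_of_nonneg_left hz hA)
  have hx₀K : x₀ ∈ K := by
    rw [hK, mem_ofPred_eq, sub_self, localNorm_zero]
    exact hr0.le
  obtain ⟨xs, hxs, hmin⟩ := hcomp.exists_isMinOn ⟨x₀, hx₀K⟩ (hg.contDiffOn.continuousOn.mono hKC)
  have hlt : localNorm a g x₀ (xs - x₀) < r := by
    refine lt_of_le_of_ne hxs fun heq => ?_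
    have h1 := le_inner_gradient_add ha hC hg hx₀ hinv hW heq hr hb
    rw [add_sub_cancel] at h1
    have h2 : 0 < r * (r - r ^ 2 + r ^ 3 / 3 - b) := mul_pos hr0 (by linarith)
    have hd := ((hg.contDiffOn.contDiffAt (hC.mem_nhds (hKC hxs))).differentiableAt
      (by norm_num)).hasFDerivAt
    have hseg : segment ℝ xs x₀ ⊆ K :=
      (convex_localNorm_le ha hC hg hx₀ r).segment_subset hxs hx₀K
    have h3 := IsLocalMinOn.hasFDerivWithinAt_nonneg hmin.localize hd.hasFDerivWithinAt
      (sub_mem_posTangentConeAt_of_segment_subset hseg)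
    rw [← inner_gradient_left, real_inner_comm, ← neg_sub, inner_neg_left] at h3
    have h4 : 0 < a⁻¹ := inv_pos.2 ha
    nlinarith
  have hnhds : K ∈ 𝓝 xs := by
    filter_upwards [(isOpen_lt hcont continuous_const).mem_nhds hlt] with z hz
    exact le_of_lt hz
  exact ⟨xs, hKC hxs, IsMinOn.of_isLocalMinOn_of_convexOn (hKC hxs)
    ((hmin.isLocalMin hnhds).on C) hg.convexOn, hlt⟩

theorem gradient_eq_zero_of_isMinOn (hC : IsOpen C) {y : EuclideanSpace ℝ (Fin n)}
    (hy : y ∈ C) (hmin : IsMinOn g C y) : gradient g y = 0 := by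
  rw [gradient, (hmin.isLocalMin (hC.mem_nhds hy)).fderiv_eq_zero, map_zero]

/-- The minimizers form a convex set, and the gradient is injective near `xs`. -/
theorem isMinOn_unique (ha : 0 < a) (hC : IsOpen C) (hg : IsSelfConcordantOn a C g)
    (hx₀ : x₀ ∈ C) (hinv : (hess g x₀).IsInvertible) (hW : dikin a g 1 x₀ ⊆ C)
    {xs y : EuclideanSpace ℝ (Fin n)} (hxs : xs ∈ C) (hmin : IsMinOn g C xs)
    (hlt : localNorm a g x₀ (xs - x₀) < 1) (hy : y ∈ C) (hminy : IsMinOn g C y) : y = xs := by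
  obtain ⟨ρ, hρ, hρ1⟩ := exists_between hlt
  have hcont : Continuous fun s : ℝ => localNorm a g x₀ (xs + s • (y - xs) - x₀) :=
    (continuous_localNorm a g x₀).comp (by fun_prop)
  have hev : ∀ᶠ s in 𝓝[>] (0 : ℝ), localNorm a g x₀ (xs + s • (y - xs) - x₀) < ρ :=
    ((hcont.tendsto 0).mono_left nhdsWithin_le_nhds).eventually
      (gt_mem_nhds (by simpa using hρ))
  obtain ⟨s, hsρ, hs0, hs1⟩ :=
    (hev.and (Ioo_mem_nhdsGT (show (0 : ℝ) < 1 by norm_num))).exists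
  set z := xs + s • (y - xs) with hz
  have hzC : z ∈ C := hg.convexOn.1.add_smul_sub_mem hxs hy ⟨hs0.le, hs1.le⟩
  have hzmin : IsMinOn g C z := by
    intro w hw
    have h1 := hg.convexOn.2 hxs hy (sub_nonneg.2 hs1.le) hs0.le (by ring)
    have h2 : (1 - s) • xs + s • y = z := by rw [hz]; module
    rw [h2, smul_eq_mul, smul_eq_mul] at h1
    have h3 : g y ≤ g xs := hminy hxs
    have h4 : g xs ≤ g w := hmin hw
    change g z ≤ g w
    nlinarith
  have h1 := mul_localNorm_sub_le_residualNorm ha hC hg hx₀ hinv hW hρ.le hsρ.le hρ1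
  rw [gradient_eq_zero_of_isMinOn hC hxs hmin, gradient_eq_zero_of_isMinOn hC hzC hzmin, sub_self,
    residualNorm_zero] at h1
  have h2 : 0 < (1 - ρ) ^ 2 := pow_pos (by linarith) 2
  have h3 : z - xs = 0 := eq_zero_of_localNorm_eq_zero ha hC hg hx₀ hinv
    (le_antisymm (by nlinarith) (localNorm_nonneg _ _ _ _))
  rw [hz, add_sub_cancel_left, smul_eq_zero] at h3
  exact sub_eq_zero.1 (h3.resolve_left hs0.ne')

/-! ### The inexact Newton method -/

variable {b θ β κ l : ℝ}

/-- One step of the method is dominated by the step `majorantStep` of the scalar iteration. -/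
theorem IsInexactNewtonStep.majorized (ha : 0 < a) (hC : IsOpen C)
    (hg : IsSelfConcordantOn a C g) (hx₀ : x₀ ∈ C) (hinv : (hess g x₀).IsInvertible)
    (hW : dikin a g 1 x₀ ⊆ C) (h : MajorantData b θ β κ l) {p : ℝ × ℝ}
    (hp : MajorantRegion b κ l p) {x s : EuclideanSpace ℝ (Fin n)}
    (hx : localNorm a g x₀ (x - x₀) ≤ p.1)
    (hres : residualNorm a g x₀ (gradient g x) ≤ scMajorant b p.1 + p.2)
    (hs : IsInexactNewtonStep a g θ x₀ x s) :
    MajorantRegion b κ l (majorantStep b θ p) ∧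
    localNorm a g x₀ s ≤ (majorantStep b θ p).1 - p.1 ∧
    localNorm a g x₀ (x + s - x₀) ≤ (majorantStep b θ p).1 ∧
    residualNorm a g x₀ (gradient g (x + s)) ≤
      scMajorant b (majorantStep b θ p).1 + (majorantStep b θ p).2 := by
  obtain ⟨⟨hst1, hst2⟩, ⟨hst3, hst4⟩, -⟩ := hp.step h
  have hl1 := h.l_lt_one
  have hlt := hp.lt
  obtain ⟨hD, -, -⟩ := hp.slope_pos h
  have hθ := h.θ_nonneg
  have hm := hp.residual_nonneg
  have hp1 := hp.nonneg
  have hs' : residualNorm a g x₀ (gradient g x + hess g x s) ≤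
      θ * (scMajorant b p.1 + p.2) := hs.trans (mul_le_mul_of_nonneg_left hres hθ)
  have ht1 : 0 < 1 - p.1 := by linarith
  have hHs : residualNorm a g x₀ (hess g x s) ≤ (1 + θ) * (scMajorant b p.1 + p.2) := by
    have h1 := residualNorm_add_le ha hC hg hx₀ (gradient g x + hess g x s) (-gradient g x)
    rw [residualNorm_neg, add_neg_cancel_comm] at h1
    linarith
  have hsle : localNorm a g x₀ s ≤ (majorantStep b θ p).1 - p.1 := by
    have h1 := mul_localNorm_le_residualNorm_hess ha hC hg hx₀ hinv hW hx (by linarith) s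
    -- the Hessian is bounded below by more than the slope of the majorant requires
    have h2 : 2 - ((1 - p.1) ^ 2)⁻¹ ≤ (1 - p.1) ^ 2 := by
      have h3 : 0 < (1 - p.1) ^ 2 := by positivity
      rw [sub_le_iff_le_add, ← sub_nonneg]
      have : (1 - p.1) ^ 2 + ((1 - p.1) ^ 2)⁻¹ - 2 =
          ((1 - p.1) ^ 2 - 1) ^ 2 / (1 - p.1) ^ 2 := by
        field_simp
        ring
      rw [this]
      positivity
    simp only [majorantStep, add_sub_cancel_left]
    rw [le_div_iff₀ hD]
    have := mul_le_mul_of_nonneg_right h2 (localNorm_nonneg a g x₀ s)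
    linarith
  have hxs : localNorm a g x₀ (x + s - x₀) ≤ (majorantStep b θ p).1 := by
    rw [add_sub_right_comm]
    linarith [localNorm_add_le ha hC hg hx₀ (x - x₀) s]
  have hres' : residualNorm a g x₀ (gradient g (x + s)) ≤
      scMajorant b (majorantStep b θ p).1 + (majorantStep b θ p).2 := by
    set δ := (majorantStep b θ p).1 - p.1 with hδ
    have hδ1 : (majorantStep b θ p).1 = p.1 + δ := by rw [hδ]; ring
    have h1 : residualNorm a g x₀ (gradient g (x + s) - gradient g x - hess g x s) ≤
        δ ^ 2 / ((1 - p.1 - δ) * (1 - p.1) ^ 2) := by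
      have : 0 < 1 - p.1 - δ := by linarith
      exact residualNorm_le ha hC hg hx₀ hinv (by positivity) fun w =>
        linearization_error_le ha hC hg hx₀ hW hx hsle (by linarith) w
    have h2 := residualNorm_add_le ha hC hg hx₀ (gradient g x + hess g x s)
      (gradient g (x + s) - gradient g x - hess g x s)
    rw [show gradient g x + hess g x s + (gradient g (x + s) - gradient g x - hess g x s) =
      gradient g (x + s) by abel] at h2
    rw [hδ1, scMajorant_add (by linarith) (by linarith)]
    have h3 : (2 - ((1 - p.1) ^ 2)⁻¹) * δ = (1 + θ) * (scMajorant b p.1 + p.2) := by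
      rw [hδ]
      simp only [majorantStep, add_sub_cancel_left]
      exact mul_div_cancel₀ _ hD.ne'
    rw [h3]
    simp only [majorantStep]
    linarith
  exact ⟨⟨hp1.trans hst1, hst2, hst3, hst4, (residualNorm_nonneg _ _ _ _).trans hres'⟩,
    hsle, hxs, hres'⟩

/-- The iterates are dominated by the scalar iteration started at `(0, 0)`. -/
theorem majorized_of_steps (ha : 0 < a) (hC : IsOpen C)
    (hg : IsSelfConcordantOn a C g) (hx₀ : x₀ ∈ C) (hinv : (hess g x₀).IsInvertible)
    (hW : dikin a g 1 x₀ ⊆ C) (h : MajorantData b θ β κ l) (hb : 0 < b)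
    (hgb : residualNorm a g x₀ (gradient g x₀) ≤ b) {N : ℕ}
    {x : ℕ → EuclideanSpace ℝ (Fin n)} (h0 : x 0 = x₀)
    (hx : ∀ k < N, IsInexactNewtonStep a g θ x₀ (x k) (x (k + 1) - x k)) {k : ℕ} (hk : k ≤ N) :
    MajorantRegion b κ l ((majorantStep b θ)^[k] (0, 0)) ∧
    localNorm a g x₀ (x k - x₀) ≤ ((majorantStep b θ)^[k] (0, 0)).1 ∧
    residualNorm a g x₀ (gradient g (x k)) ≤
      scMajorant b ((majorantStep b θ)^[k] (0, 0)).1 + ((majorantStep b θ)^[k] (0, 0)).2 ∧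
    scMajorant b ((majorantStep b θ)^[k] (0, 0)).1 + ((majorantStep b θ)^[k] (0, 0)).2 ≤
      ((1 + θ ^ 2) / 2) ^ k * b := by
  induction k with
  | zero =>
    refine ⟨majorantRegion_zero h hb, ?_, ?_, ?_⟩
    · simp [h0, localNorm_zero]
    · simpa [h0, scMajorant] using hgb
    · simp [scMajorant]
  | succ k ih =>
    obtain ⟨h1, h2, h3, h4⟩ := ih (by omega)
    obtain ⟨h5, -, h6, h7⟩ :=
      (hx k (by omega)).majorized ha hC hg hx₀ hinv hW h h1 h2 h3
    rw [add_sub_cancel] at h6 h7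
    rw [Function.iterate_succ_apply']
    refine ⟨h5, h6, h7, (h1.step h).2.2.trans ?_⟩
    rw [pow_succ' _ k, mul_assoc]
    exact mul_le_mul_of_nonneg_left h4 (by positivity)

/-- The distance from a zero of the gradient after one step, in terms of a bound `e` for the
linearization error at that zero. -/
theorem IsInexactNewtonStep.error_le (ha : 0 < a) (hC : IsOpen C)
    (hg : IsSelfConcordantOn a C g) (hx₀ : x₀ ∈ C) (hinv : (hess g x₀).IsInvertible)
    (hW : dikin a g 1 x₀ ⊆ C) (hθ : 0 ≤ θ) {x s xs : EuclideanSpace ℝ (Fin n)} {t e : ℝ}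
    (hx : localNorm a g x₀ (x - x₀) ≤ t) (ht : t < 1) (hxs : gradient g xs = 0)
    (he : residualNorm a g x₀ (gradient g xs - gradient g x - hess g x (xs - x)) ≤ e)
    (hs : IsInexactNewtonStep a g θ x₀ x s) :
    (1 - t) ^ 2 * localNorm a g x₀ (xs - (x + s)) ≤
      (1 + θ) * e + θ * (localNorm a g x₀ (xs - x) / (1 - t) ^ 2) := by
  set E := gradient g xs - gradient g x - hess g x (xs - x) with hE
  have h1 := mul_localNorm_le_residualNorm_hess ha hC hg hx₀ hinv hW hx ht (xs - (x + s))
  have e1 : hess g x (xs - (x + s)) = -E + -(gradient g x + hess g x s) := by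
    rw [hE, hxs, ← sub_sub, map_sub]
    abel
  have h2 := residualNorm_add_le ha hC hg hx₀ (-E) (-(gradient g x + hess g x s))
  rw [← e1, residualNorm_neg, residualNorm_neg] at h2
  have e2 : gradient g x = -E + -hess g x (xs - x) := by
    rw [hE, hxs]
    abel
  have h3 := residualNorm_add_le ha hC hg hx₀ (-E) (-hess g x (xs - x))
  rw [← e2, residualNorm_neg, residualNorm_neg] at h3
  have h4 := residualNorm_hess_le ha hC hg hx₀ hinv hW hx ht (xs - x)
  have h5 : θ * residualNorm a g x₀ (gradient g x) ≤
      θ * (e + localNorm a g x₀ (xs - x) / (1 - t) ^ 2) :=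
    mul_le_mul_of_nonneg_left (by linarith) hθ
  have h6 : residualNorm a g x₀ (gradient g x + hess g x s) ≤
    θ * residualNorm a g x₀ (gradient g x) := hs
  linarith

theorem IsInexactNewtonStep.error_le_quadratic (ha : 0 < a) (hC : IsOpen C)
    (hg : IsSelfConcordantOn a C g) (hx₀ : x₀ ∈ C) (hinv : (hess g x₀).IsInvertible)
    (hW : dikin a g 1 x₀ ⊆ C) (h : MajorantData b θ β κ l)
    {x s xs : EuclideanSpace ℝ (Fin n)} (hx : localNorm a g x₀ (x - x₀) ≤ l)
    (hxs : gradient g xs = 0) (hxs' : localNorm a g x₀ (xs - x₀) ≤ l)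
    (hs : IsInexactNewtonStep a g θ x₀ x s) :
    localNorm a g x₀ (xs - (x + s)) ≤
      ((1 + θ) / 2 * (derivWithin (deriv (scMajorant b)) (Iio l) l / |deriv (scMajorant b) l|) *
          localNorm a g x₀ (xs - x) +
        θ * ((deriv (scMajorant b) l + 2) / |deriv (scMajorant b) l|)) *
      localNorm a g x₀ (xs - x) := by
  have hl := h.l_lt_one
  have hl1 : 0 < 1 - l := by linarith
  have hκ := h.κ_pos
  have hd : deriv (scMajorant b) l = -κ := by
    rw [(hasDerivAt_scMajorant b hl).deriv, h.one_sub_l, h.κ_eq, inv_pow, inv_inv]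
    ring
  have hinvsq : ((1 - l) ^ 2)⁻¹ = 2 - κ := by
    rw [h.one_sub_l, h.κ_eq, inv_pow, inv_inv]
    ring
  have hN := localNorm_nonneg a g x₀ (xs - x)
  have key := hs.error_le ha hC hg hx₀ hinv hW h.θ_nonneg hx hl hxs
    (residualNorm_le ha hC hg hx₀ hinv (by positivity) fun w =>
      linearization_error_le_sq ha hC hg hx₀ hW hx hxs' hl w)
  have h1 := mul_le_mul_of_nonneg_right h.κ_le_sq (localNorm_nonneg a g x₀ (xs - (x + s)))
  rw [derivWithin_deriv_scMajorant b hl, hd, abs_neg, abs_of_pos hκ]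
  rw [div_eq_mul_inv (localNorm a g x₀ (xs - x)), hinvsq] at key
  refine le_of_mul_le_mul_left (h1.trans (key.trans (le_of_eq ?_))) hκ
  field_simp
  ring

/-- As `δ ≤ l - t`, the convexity of the majorant's derivative makes the quadratic term linear
in `δ` with a factor free of `t`; here `X` is the error after the step. -/
theorem error_factor_le {t δ X : ℝ} (h : MajorantData b θ β κ l) (ht : 0 ≤ t) (htl : t < l)
    (hδ : 0 ≤ δ) (hδl : δ ≤ l - t) (hX : 0 ≤ X)
    (hle : (1 - t) ^ 2 * X ≤
      (1 + θ) * (δ ^ 2 / ((1 - t - δ) * (1 - t) ^ 2)) + θ * (δ / (1 - t) ^ 2)) :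
    X ≤ ((1 + θ) / 2 + 2 * θ / κ) * δ := by
  have hl1 := h.l_lt_one
  have h1l := h.one_sub_l
  have hβ := h.β_pos
  have hθ := h.θ_nonneg
  have hW2 := h.sq_lt
  have hκ0 := h.κ_pos
  have hκ := h.κ_eq
  obtain ⟨W, hW⟩ : ∃ W, W = 1 + β := ⟨_, rfl⟩
  rw [← hW] at hW2 h1l hκ
  have ht1 : 0 < 1 - t := by linarith
  set w := (1 - t)⁻¹ with hw
  have htw : 1 - t = w⁻¹ := by rw [hw, inv_inv]
  have hw0 : 0 < w := inv_pos.2 ht1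
  have hW0 : 0 < W := by linarith
  have hwW : w < W := by
    rw [hw, inv_lt_comm₀ ht1 hW0, ← h1l]
    linarith
  have hD : 0 < 2 - w ^ 2 := by nlinarith
  have e1 : δ ^ 2 / ((1 - t - δ) * (1 - t) ^ 2) ≤ δ * (w * (W - w)) := by
    have e2 : W⁻¹ ≤ 1 - t - δ := by linarith
    have e3 : δ * (w * W) ≤ W - w := by
      have e4 : l - t = w⁻¹ - W⁻¹ := by rw [← htw, ← h1l]; ring
      have e5 : w⁻¹ - W⁻¹ = (W - w) / (w * W) := by field_simp
      exact (le_div_iff₀ (by positivity)).1 (by linarith)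
    calc δ ^ 2 / ((1 - t - δ) * (1 - t) ^ 2) ≤ δ ^ 2 / (W⁻¹ * (1 - t) ^ 2) := by
          gcongr
      _ = δ * w * (δ * (w * W)) := by rw [htw]; field_simp
      _ ≤ δ * w * (W - w) := by gcongr
      _ = _ := by ring
  have e6 : δ / (1 - t) ^ 2 = δ * w ^ 2 := by rw [htw]; field_simp
  have e7 : 2 - w ^ 2 ≤ (1 - t) ^ 2 := by
    have e8 : (1 - t) ^ 2 * w ^ 2 = 1 := by rw [htw]; field_simp
    nlinarith [sq_nonneg (w ^ 2 - 1), sq_nonneg w, pow_pos hw0 2]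
  have e9 : w * (W - w) ≤ (2 - w ^ 2) / 2 := by nlinarith [sq_nonneg (W - w)]
  have e10 : w ^ 2 ≤ 2 / κ * (2 - w ^ 2) := by
    rw [div_mul_eq_mul_div, le_div_iff₀ hκ0, hκ]
    nlinarith [mul_pos hD (pow_pos hW0 2), pow_pos hw0 2, pow_pos hW0 2]
  have e11 : (2 - w ^ 2) * X ≤ (2 - w ^ 2) * (((1 + θ) / 2 + 2 * θ / κ) * δ) := by
    rw [e6] at hle
    calc (2 - w ^ 2) * X ≤ (1 - t) ^ 2 * X := by gcongr
      _ ≤ (1 + θ) * (δ ^ 2 / ((1 - t - δ) * (1 - t) ^ 2)) + θ * (δ * w ^ 2) := hle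
      _ ≤ (1 + θ) * (δ * ((2 - w ^ 2) / 2)) + θ * (δ * (2 / κ * (2 - w ^ 2))) := by
        gcongr
        exact e1.trans (by gcongr)
      _ = _ := by ring
  exact le_of_mul_le_mul_left e11 hD

/-- Linear decrease of the error, if `x` is as close to `xs` as the scalar iterate `t` is to
`l`. -/
theorem IsInexactNewtonStep.error_le_linear (ha : 0 < a) (hC : IsOpen C)
    (hg : IsSelfConcordantOn a C g) (hx₀ : x₀ ∈ C) (hinv : (hess g x₀).IsInvertible)
    (hW : dikin a g 1 x₀ ⊆ C) (h : MajorantData b θ β κ l)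
    {x s xs : EuclideanSpace ℝ (Fin n)} {t : ℝ} (ht0 : 0 ≤ t) (htl : t < l)
    (hx : localNorm a g x₀ (x - x₀) ≤ t) (hxs : gradient g xs = 0)
    (hxs' : localNorm a g x₀ (xs - x) ≤ l - t) (hs : IsInexactNewtonStep a g θ x₀ x s) :
    localNorm a g x₀ (xs - (x + s)) ≤
      ((1 + θ) / 2 + 2 * θ / κ) * localNorm a g x₀ (xs - x) := by
  have hl := h.l_lt_one
  have hN := localNorm_nonneg a g x₀ (xs - x)
  have hpos : 0 < 1 - t - localNorm a g x₀ (xs - x) := by linarith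
  refine error_factor_le h ht0 htl hN hxs' (localNorm_nonneg _ _ _ _)
    (hs.error_le ha hC hg hx₀ hinv hW h.θ_nonneg hx (by linarith) hxs
      (residualNorm_le ha hC hg hx₀ hinv (by positivity) fun w => ?_))
  have := linearization_error_le ha hC hg hx₀ hW hx (le_refl (localNorm a g x₀ (xs - x)))
    (by linarith) w
  rwa [add_sub_cancel] at this

/-- As the residuals tend to zero, strong monotonicity of the gradient gives convergence. -/
theorem tendsto_of_majorized (ha : 0 < a) (hC : IsOpen C)
    (hg : IsSelfConcordantOn a C g) (hx₀ : x₀ ∈ C) (hinv : (hess g x₀).IsInvertible)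
    (hW : dikin a g 1 x₀ ⊆ C) {q ρ : ℝ} (hq0 : 0 ≤ q) (hq1 : q < 1) (hρ : ρ < 1)
    {x : ℕ → EuclideanSpace ℝ (Fin n)} {xs : EuclideanSpace ℝ (Fin n)}
    (hx : ∀ k, localNorm a g x₀ (x k - x₀) ≤ ρ) (hxs : localNorm a g x₀ (xs - x₀) ≤ ρ)
    (hgrad : gradient g xs = 0)
    (hres : ∀ k, residualNorm a g x₀ (gradient g (x k)) ≤ q ^ k * b) :
    Tendsto x atTop (𝓝 xs) := by
  obtain ⟨A, hA, hAle⟩ := exists_norm_le_mul_localNorm ha hC hg hx₀ hinv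
  have hρ0 : 0 < (1 - ρ) ^ 2 := pow_pos (by linarith) 2
  rw [tendsto_iff_norm_sub_tendsto_zero]
  have hlim : Tendsto (fun k => A * (q ^ k * b / (1 - ρ) ^ 2)) atTop (𝓝 0) := by
    have := (((tendsto_pow_atTop_nhds_zero_of_lt_one hq0 hq1).mul_const b).div_const
      ((1 - ρ) ^ 2)).const_mul A
    simpa using this
  refine squeeze_zero (fun k => norm_nonneg _) (fun k => (hAle _).trans ?_) hlim
  refine mul_le_mul_of_nonneg_left ?_ hA
  rw [le_div_iff₀ hρ0]
  have h1 := mul_localNorm_sub_le_residualNorm ha hC hg hx₀ hinv hW hxs (hx k) hρ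
  rw [hgrad, sub_zero] at h1
  linarith [hres k]

/-- The bound by the scalar sequence for the distance that the vector iteration has still
to go. -/
theorem localNorm_limit_sub_le (ha : 0 < a) (hC : IsOpen C)
    (hg : IsSelfConcordantOn a C g) (hx₀ : x₀ ∈ C) {T : ℕ → ℝ}
    {x : ℕ → EuclideanSpace ℝ (Fin n)} {xs : EuclideanSpace ℝ (Fin n)}
    (hstep : ∀ k, localNorm a g x₀ (x (k + 1) - x k) ≤ T (k + 1) - T k) (hT : ∀ k, T k < l)
    (hlim : Tendsto x atTop (𝓝 xs)) (k : ℕ) : localNorm a g x₀ (xs - x k) ≤ l - T k := by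
  have hle : ∀ j, localNorm a g x₀ (x (j + k) - x k) ≤ T (j + k) - T k := by
    intro j
    induction j with
    | zero => simp [localNorm_zero]
    | succ j ih =>
      have h1 := localNorm_add_le ha hC hg hx₀ (x (j + k + 1) - x (j + k)) (x (j + k) - x k)
      rw [sub_add_sub_cancel] at h1
      rw [add_right_comm j 1 k]
      linarith [hstep (j + k)]
  have h2 : Tendsto (fun j => localNorm a g x₀ (x (j + k) - x k)) atTop
      (𝓝 (localNorm a g x₀ (xs - x k))) :=
    ((continuous_localNorm a g x₀).tendsto _).comp
      (((tendsto_add_atTop_iff_nat k).2 hlim).sub_const (x k))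
  exact le_of_tendsto' h2 fun j => (hle j).trans (by linarith [hT (j + k)])

end SelfConcordant

/-- The smaller root `t` of the majorant lies in `(0, 1)`, and there the lower bound
`t - t² + t³ / 3` for the growth of the gradient exceeds `b`. -/
theorem smaller_root_bounds {b t : ℝ} (hb : 0 < b) (hb' : b < 3 - 2 * √2)
    (ht : t = (1 + b - √(1 - 6 * b + b ^ 2)) / 4) :
    0 < t ∧ t < 1 ∧ b < t - t ^ 2 + t ^ 3 / 3 := by
  have h2 : √(2 : ℝ) ^ 2 = 2 := Real.sq_sqrt (by norm_num)
  have h20 : 0 < √(2 : ℝ) := by positivity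
  have hdisc : 0 ≤ 1 - 6 * b + b ^ 2 := by nlinarith
  have hsq := Real.sq_sqrt hdisc
  have hs0 := Real.sqrt_nonneg (1 - 6 * b + b ^ 2)
  set r := √(1 - 6 * b + b ^ 2)
  have hr : r = 1 + b - 4 * t := by rw [ht]; ring
  have hrlt : r < 1 + b := by nlinarith
  have ht0 : 0 < t := by linarith
  have ht1 : t < 1 := by linarith
  refine ⟨ht0, ht1, ?_⟩
  have hroot : b * (1 - t) = t - 2 * t ^ 2 := by
    rw [hr] at hsq
    linarith
  have h3 : b * (1 - t) < (t - t ^ 2 + t ^ 3 / 3) * (1 - t) := by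
    rw [hroot]
    have : 0 < t ^ 3 * (4 - t) := by
      apply mul_pos (by positivity); linarith
    nlinarith
  exact lt_of_mul_lt_mul_right h3 (by linarith)

theorem theorem4 (n : ℕ) (C : Set (EuclideanSpace ℝ (Fin n))) (hCopen : IsOpen C)
    (hCconv : Convex ℝ C) (g : EuclideanSpace ℝ (Fin n) → ℝ) (a : ℝ) (ha : 0 < a)
    (hg : IsSelfConcordantOn a C g)
    (x₀ : EuclideanSpace ℝ (Fin n)) (hx₀ : x₀ ∈ C) (hinv : (hess g x₀).IsInvertible)
    -- either `W_1(x₀) ⊆ C`, or `g` has closed sublevel sets (`g` is strongly self-concordant)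
    (hdom : dikin a g 1 x₀ ⊆ C ∨ ∀ c : ℝ, IsClosed {x | x ∈ C ∧ g x ≤ c})
    (b : ℝ) (hb : 0 < b) (hb' : b < 3 - 2 * √2)
    (hgb : localNorm a g x₀ ((hess g x₀).inverse (gradient g x₀)) ≤ b)
    (θ : ℝ) (hθ : 0 ≤ θ) (hθ' : θ ≤ (1 - 2 * √b - b) / (1 + 2 * √b + b))
    (lam tstar : ℝ) (hlam : lam = b / (√b + b))
    (htstar : tstar = (1 + b - √(1 - 6 * b + b ^ 2)) / 4) :
    -- the method is well defined: after finitely many admissible steps, whatever they are,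
    -- the iterate is in `C`, the Hessian there is nonsingular, and there is a further step
    (∀ (N : ℕ) (x : ℕ → EuclideanSpace ℝ (Fin n)), x 0 = x₀ →
      (∀ k < N, IsInexactNewtonStep a g θ x₀ (x k) (x (k + 1) - x k)) →
      x N ∈ C ∧ (hess g (x N)).IsInvertible ∧ ∃ s, IsInexactNewtonStep a g θ x₀ (x N) s) ∧
    -- the unique global minimizer, the limit of every sequence the method can generate
    ∃ xs ∈ C, IsMinOn g C xs ∧ (∀ y ∈ C, IsMinOn g C y → y = xs) ∧
      xs ∈ dikin a g tstar x₀ ∧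
      ∀ x : ℕ → EuclideanSpace ℝ (Fin n), x 0 = x₀ →
        (∀ k, IsInexactNewtonStep a g θ x₀ (x k) (x (k + 1) - x k)) →
        Tendsto x atTop (𝓝 xs) ∧
        (∀ k, residualNorm a g x₀ (gradient g (x k)) ≤ ((1 + θ ^ 2) / 2) ^ k * b) ∧
        (∀ k, x k ∈ dikin a g lam x₀) ∧
        (∀ k, localNorm a g x₀ (xs - x (k + 1)) ≤
          ((1 + θ) / 2 *
              (derivWithin (deriv (scMajorant b)) (Iio lam) lam / |deriv (scMajorant b) lam|) *
              localNorm a g x₀ (xs - x k) +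
            θ * ((deriv (scMajorant b) lam + 2) / |deriv (scMajorant b) lam|)) *
          localNorm a g x₀ (xs - x k)) ∧
        (θ < (1 - 2 * √b - b) / (5 - 2 * √b - b) →
          (1 + θ) / 2 + 2 * θ / (1 - 2 * √b - b) < 1 ∧
          ∀ k, localNorm a g x₀ (xs - x (k + 1)) ≤
            ((1 + θ) / 2 + 2 * θ / (1 - 2 * √b - b)) * localNorm a g x₀ (xs - x k)) := by
  have hW : dikin a g 1 x₀ ⊆ C :=
    hdom.elim id fun h => dikin_one_subset ha hCopen hCconv hg hx₀ h
  have h := majorantData_of hb hb' hθ hθ' hlam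
  have hsteps := fun {N : ℕ} {x : ℕ → EuclideanSpace ℝ (Fin n)} (h0 : x 0 = x₀)
      (hx : ∀ k < N, IsInexactNewtonStep a g θ x₀ (x k) (x (k + 1) - x k)) {k : ℕ} (hk : k ≤ N) =>
    majorized_of_steps ha hCopen hg hx₀ hinv hW h hb hgb h0 hx hk
  refine ⟨fun N x h0 hx => ?_, ?_⟩
  · obtain ⟨h1, h2, -, -⟩ := hsteps h0 hx le_rfl
    have h3 : localNorm a g x₀ (x N - x₀) < 1 := (h2.trans_lt h1.lt).trans h.l_lt_one
    have h4 := isInvertible_hess_of_dikin ha hCopen hg hx₀ hinv hW h3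
    refine ⟨hW h3, h4, (hess g (x N)).inverse (-gradient g (x N)), ?_⟩
    rw [IsInexactNewtonStep, hess_inverse_apply h4, add_neg_cancel, residualNorm_zero]
    exact mul_nonneg hθ (residualNorm_nonneg _ _ _ _)
  obtain ⟨ht0, ht1, hbt⟩ := smaller_root_bounds hb hb' htstar
  obtain ⟨xs, hxsC, hmin, hlt⟩ := exists_isMinOn ha hCopen hg hx₀ hinv hW ht0 ht1 hbt hgb
  have hgrad := gradient_eq_zero_of_isMinOn hCopen hxsC hmin
  refine ⟨xs, hxsC, hmin, fun y hy hminy =>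
    isMinOn_unique ha hCopen hg hx₀ hinv hW hxsC hmin (hlt.trans ht1) hy hminy, hlt,
    fun x h0 hx => ?_⟩
  have hinvk := fun k => hsteps (N := k) h0 (fun j _ => hx j) le_rfl
  have hlam1 := h.l_lt_one
  have hres : ∀ k, residualNorm a g x₀ (gradient g (x k)) ≤ ((1 + θ ^ 2) / 2) ^ k * b :=
    fun k => (hinvk k).2.2.1.trans (hinvk k).2.2.2
  have hxlam : ∀ k, localNorm a g x₀ (x k - x₀) < lam := fun k =>
    (hinvk k).2.1.trans_lt (hinvk k).1.lt
  have hθ1 := h.θ_lt_one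
  have hlim : Tendsto x atTop (𝓝 xs) :=
    tendsto_of_majorized ha hCopen hg hx₀ hinv hW (by positivity) (by nlinarith)
      (max_lt hlam1 ht1) (fun k => (hxlam k).le.trans (le_max_left _ _))
      (hlt.le.trans (le_max_right _ _)) hgrad hres
  have hdist : ∀ k, localNorm a g x₀ (xs - x k) ≤
      lam - ((majorantStep b θ)^[k] (0, 0)).1 := by
    refine localNorm_limit_sub_le ha hCopen hg hx₀ (fun k => ?_) (fun k => (hinvk k).1.lt) hlim
    rw [Function.iterate_succ_apply']
    exact ((hx k).majorized ha hCopen hg hx₀ hinv hW h (hinvk k).1 (hinvk k).2.1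
      (hinvk k).2.2.1).2.1
  have hxslam : localNorm a g x₀ (xs - x₀) ≤ lam := by simpa [h0] using hdist 0
  refine ⟨hlim, hres, hxlam, fun k => ?_, fun hθκ => ⟨?_, fun k => ?_⟩⟩
  · have := (hx k).error_le_quadratic ha hCopen hg hx₀ hinv hW h (hxlam k).le hgrad hxslam
    rwa [add_sub_cancel] at this
  · have hκ := h.κ_pos
    rw [lt_div_iff₀ (by linarith)] at hθκ
    have h1 : 2 * θ / (1 - 2 * √b - b) < 1 - (1 + θ) / 2 := by
      rw [div_lt_iff₀ hκ]
      nlinarith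
    linarith
  · have := (hx k).error_le_linear ha hCopen hg hx₀ hinv hW h (hinvk k).1.nonneg (hinvk k).1.lt
      (hinvk k).2.1 hgrad (hdist k)
    rwa [add_sub_cancel] at this
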